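/- **Theorem 1.1.** Let $V\subseteq\mathbb{P}^N(\mathbb{C})$ be a complex projective algebraic variety (a Zariski closed subset, not necessarily irreducible), and let $D_1,\dots,D_q$ be hypersurfaces of $\mathbb{P}^N(\mathbb{C})$ (given by nonzero homogeneous polynomials of positive degree) such that $$\dim\Big(\bigcap_{1\le i\le q}\operatorname{Supp}D_i\cap V\Big)=0 .$$ Let $f:\mathbb{C}\to V$ be a holomorphic curve with homogeneous representation $(f_0,\dots,f_N)$, i.e. the $f_j$ are entire functions without common zeros and $f=[f_0:\dots:f_N]$. Let $$\|f'\|^2=\frac{\sum_{i\ne j}|f_i'f_j-f_if_j'|^2}{\big(\sum_{j}|f_j|^2\big)^2},\qquad T_f(r)=\int_0^r\frac{dt}{t}\Big(\frac1\pi\int_{|z|\le t}\|f'\|^2(z)\,dm_z\Big)$$ be the (squared) Fubini–Study derivative and the Nevanlinna characteristic of $f$, where $dm$ is the area element of $\mathbb{C}$. Suppose that $\|f'(z)\|=O(|z|^\sigma)$ as $z\to\infty$ for some real $\sigma>-1$, and that $$\Big(\bigcup_{1\le i\le q}\operatorname{Supp}D_i\Big)\cap f(\mathbb{C})=\emptyset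 .$$ Then $T_f(r)=O(r^{\sigma+1})$ as $r\to\infty$. -/

import Mathlib

open MeasureTheory Filter Asymptotics Topology

noncomputable section

namespace HolCurves

/-- Complex projective space `ℙ^N(ℂ)`: lines through the origin in `ℂ^(N+1)`. -/
abbrev ProjSpace (N : ℕ) : Type := Projectivization ℂ (Fin (N + 1) → ℂ)

/-- The set of points of `ℙ^N(ℂ)` at which the polynomial `P` vanishes. It is used only for
homogeneous `P`, where the choice of the representative is immaterial (`mk_mem_zeroSet_iff`). -/
def zeroSet {N : ℕ} (P : MvPolynomial (Fin (N + 1)) ℂ) : Set (ProjSpace N) :=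
  {p | MvPolynomial.eval p.rep P = 0}

/-- A homogeneous polynomial of degree `d` satisfies `P(c v) = c^d P(v)`. -/
theorem eval_smul_of_isHomogeneous {N d : ℕ} {P : MvPolynomial (Fin (N + 1)) ℂ}
    (hP : P.IsHomogeneous d) (c : ℂ) (v : Fin (N + 1) → ℂ) :
    MvPolynomial.eval (c • v) P = c ^ d * MvPolynomial.eval v P := by
  rw [MvPolynomial.eval_eq, MvPolynomial.eval_eq, Finset.mul_sum]
  refine Finset.sum_congr rfl fun m hm => ?_
  have hdeg : ∑ i ∈ m.support, m i = d := by
    have h := hP (MvPolynomial.mem_support_iff.mp hm)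
    rw [Finsupp.weight_apply, Finsupp.sum] at h
    simpa using h
  simp only [Pi.smul_apply, smul_eq_mul, mul_pow, Finset.prod_mul_distrib,
    Finset.prod_pow_eq_pow_sum, hdeg]
  ring

/-- For homogeneous `P`, the point `[v]` lies in the zero set of `P` iff `P(v) = 0`. -/
theorem mk_mem_zeroSet_iff {N d : ℕ} {P : MvPolynomial (Fin (N + 1)) ℂ}
    (hP : P.IsHomogeneous d) (v : Fin (N + 1) → ℂ) (hv : v ≠ 0) :
    Projectivization.mk ℂ v hv ∈ zeroSet P ↔ MvPolynomial.eval v P = 0 := by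
  obtain ⟨a, ha⟩ := Projectivization.exists_smul_eq_mk_rep ℂ v hv
  have ha' : (a : ℂ) • v = (Projectivization.mk ℂ v hv).rep := ha
  have h0 : (a : ℂ) ^ d ≠ 0 := pow_ne_zero _ a.ne_zero
  simp only [zeroSet, Set.mem_ofPred_eq, ← ha', eval_smul_of_isHomogeneous hP, mul_eq_zero, h0,
    false_or]

/-- A projective algebraic set: the common zero set of a set of homogeneous polynomials. -/
def IsAlgebraicSet {N : ℕ} (V : Set (ProjSpace N)) : Prop :=
  ∃ S : Set (MvPolynomial (Fin (N + 1)) ℂ),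
    (∀ P ∈ S, ∃ d : ℕ, P.IsHomogeneous d) ∧ V = ⋂ P ∈ S, zeroSet P

/-- The Zariski topology of `ℙ^N(ℂ)`: the closed sets are the projective algebraic sets. -/
@[reducible] def zariski (N : ℕ) : TopologicalSpace (ProjSpace N) :=
  TopologicalSpace.ofClosed {V | IsAlgebraicSet V}
    (by
      refine ⟨{1}, ?_, ?_⟩
      · rintro P rfl
        exact ⟨0, MvPolynomial.isHomogeneous_one _ _⟩
      · ext p
        simp [zeroSet])
    (by
      intro A hA
      refine ⟨{P | (∃ d : ℕ, P.IsHomogeneous d) ∧ ∃ V ∈ A, V ⊆ zeroSet P}, fun P hP => hP.1, ?_⟩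
      ext p
      constructor
      · intro h
        refine Set.mem_iInter₂.mpr ?_
        rintro P ⟨_, V, hVA, hVP⟩
        exact hVP (h V hVA)
      · intro h V hVA
        obtain ⟨S, hS, hVS⟩ := hA hVA
        rw [hVS]
        refine Set.mem_iInter₂.mpr fun P hP => Set.mem_iInter₂.mp h P ⟨hS P hP, V, hVA, ?_⟩
        rw [hVS]
        exact Set.biInter_subset_of_mem hP)
    (by
      rintro V ⟨S, hS, rfl⟩ W ⟨T, hT, rfl⟩
      refine ⟨{R | ∃ P ∈ S, ∃ Q ∈ T, R = P * Q}, ?_, ?_⟩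
      · rintro R ⟨P, hP, Q, hQ, rfl⟩
        obtain ⟨m, hm⟩ := hS P hP
        obtain ⟨n, hn⟩ := hT Q hQ
        exact ⟨m + n, hm.mul hn⟩
      · ext p
        simp only [Set.mem_union, Set.mem_iInter, Set.mem_ofPred_eq]
        constructor
        · rintro (h | h) R ⟨P, hP, Q, hQ, rfl⟩
          · have h1 : MvPolynomial.eval p.rep P = 0 := h P hP
            simp [zeroSet, h1]
          · have h1 : MvPolynomial.eval p.rep Q = 0 := h Q hQ
            simp [zeroSet, h1]
        · intro h
          by_contra! hcon
          obtain ⟨⟨P, hP, hPp⟩, Q, hQ, hQp⟩ := hcon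
          have h1 : MvPolynomial.eval p.rep (P * Q) = 0 := h _ ⟨P, hP, Q, hQ, rfl⟩
          rw [map_mul] at h1
          rcases mul_eq_zero.mp h1 with h2 | h2
          · exact hPp h2
          · exact hQp h2)

theorem isClosed_zariski_iff {N : ℕ} (V : Set (ProjSpace N)) :
    IsClosed[zariski N] V ↔ IsAlgebraicSet V := by
  rw [← @isOpen_compl_iff _ _ (zariski N)]
  change IsAlgebraicSet Vᶜᶜ ↔ _
  rw [compl_compl]

/-- The dimension of a subset of `ℙ^N(ℂ)`: its Krull dimension in the Zariski topology.
The empty set has dimension `⊥`. -/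
def algDim {N : ℕ} (X : Set (ProjSpace N)) : WithBot ℕ∞ :=
  @topologicalKrullDim X (TopologicalSpace.induced Subtype.val (zariski N))

/-- A hypersurface of `ℙ^N(ℂ)`, possibly reducible or with multiplicities (an effective divisor),
given by a homogeneous defining polynomial of positive degree. -/
structure Hypersurface (N : ℕ) where
  degree : ℕ
  poly : MvPolynomial (Fin (N + 1)) ℂ
  degree_pos : 0 < degree
  poly_ne_zero : poly ≠ 0
  isHomogeneous : poly.IsHomogeneous degree

/-- The support of a hypersurface. -/
def Hypersurface.supp {N : ℕ} (D : Hypersurface N) : Set (ProjSpace N) := zeroSet D.poly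

/-- `F = (F_0, …, F_N)` is a homogeneous representation of `f : ℂ → ℙ^N(ℂ)`: the `F_j` are entire
functions that never vanish simultaneously, and `f(z) = [F_0(z) : … : F_N(z)]`. -/
def IsHomogeneousRep {N : ℕ} (F : Fin (N + 1) → ℂ → ℂ) (f : ℂ → ProjSpace N) : Prop :=
  (∀ j, Differentiable ℂ (F j)) ∧
    ∀ z, ∃ h : (fun j => F j z) ≠ 0, f z = Projectivization.mk ℂ (fun j => F j z) h

/-- The Fubini–Study derivative `‖f'‖(z)`, where
`‖f'‖² = ∑_{i ≠ j} |F_i' F_j - F_i F_j'|² / ‖F‖⁴`. -/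
def fsDeriv {N : ℕ} (F : Fin (N + 1) → ℂ → ℂ) (z : ℂ) : ℝ :=
  Real.sqrt
    ((∑ i, ∑ j ∈ Finset.univ.erase i, ‖deriv (F i) z * F j z - F i z * deriv (F j) z‖ ^ 2) /
      (∑ j, ‖F j z‖ ^ 2) ^ 2)

/-- The Nevanlinna characteristic
`T_f(r) = ∫_0^r (1/t) ((1/π) ∫_{|z| ≤ t} ‖f'‖²(z) dm(z)) dt`. -/
def characteristic {N : ℕ} (F : Fin (N + 1) → ℂ → ℂ) (r : ℝ) : ℝ :=
  ∫ t in (0 : ℝ)..r, (1 / t) * ((1 / Real.pi) * ∫ z in Metric.closedBall (0 : ℂ) t, fsDeriv F z ^ 2)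

end HolCurves

end

/-!
Write `u = log ‖F‖`. By Jensen's formula (`characteristic_eq_circleAverage`) `T_f(r)` equals
twice the mean of `u` over `|z| = r` minus `2 u(0)`. A circle average does not grow when a harmonic
function is subtracted from `u`, so it is enough to find a zero-free entire function `H` and a
constant `B` with `u ≤ B log |H| + O((1 + |z|) ^ (σ + 1))` pointwise.

The set `⋂ supp D_i ∩ V` is finite (`finite_of_algDim_eq_zero`), hence some linear form has no zero
on it. Powers of this form and of the equations of the `D_i` are forms `Q_0, …, Q_q` of one degree
`d` without common zero on `V` (`exists_forms`). Put `G_i = Q_i(F)`; then `G_1, …, G_q` have no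
zeros, and `max |G_i|` is comparable to `‖F‖ ^ d` by compactness. By Euler's identity the Wronskian
`G_i' G_j - G_i G_j'` is a combination of the `F_k' F_l - F_k F_l'`, so that at a *tie*, a point
where `|G_i| = |G_j| = max_k |G_k|`, the gradient of `log |G_i| - log |G_j|` is at most a constant
times the Fubini–Study derivative, i.e. `O((1 + |z|) ^ σ)`.

The heart of the proof is `TieBound.elim`, which removes one function `G_a` from such a family.
Suppose `|G_a|` exceeds all other `|G_i|` at `z₀`, and let `R` be the radius of the largest disc
about `z₀` on which this persists. On the boundary of the disc there is a tie of `G_a` with some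
`G_k`. As `log |G_a / G_k|` is positive and harmonic in the disc and vanishes at the tie, Harnack's
inequality bounds it at `z₀` by `2 R` times the gradient at the tie. Thus dropping `G_a` changes the
maximum at `z₀` by a factor `exp (O((1 + |z₀|) ^ (σ + 1)))` only. If moreover `G_i` and `G_j` are
tied for the maximum of the remaining functions at `z₀`, then `log |G_a / G_i|` and `log |G_a / G_j|`
are positive harmonic functions on the disc which obey the same bound at `z₀`, so their gradients
there are `O((1 + |z₀|) ^ σ)`, and the smaller family satisfies the same hypothesis. Eliminating the
functions one at a time, starting with `G_0`, the only one that may have zeros, leaves a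
zero-free `G_k` which is the required `H`.

The touching point of the disc may lie near the origin, which is harmless if the exponent is
nonnegative. Substituting `z = w ^ n` with `n (σ + 1) ≥ 1` replaces `σ` by `n (σ + 1) - 1 ≥ 0` and
so covers all `σ > -1`.
-/

open scoped ComplexConjugate

noncomputable section

namespace HolCurves

/-! ### Positive harmonic functions on a disc -/

/-- A branch of `log φ` on a disc where `φ` has no zeros. Only its derivative and its real part are
needed. -/
theorem exists_holomorphic_log {φ : ℂ → ℂ} (hφ : Differentiable ℂ φ) {c : ℂ} {R : ℝ}
    (hR : 0 < R) (h0 : ∀ z ∈ Metric.ball c R, φ z ≠ 0) :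
    ∃ L : ℂ → ℂ, ∀ z ∈ Metric.ball c R,
      HasDerivAt L (logDeriv φ z) z ∧ (L z).re = Real.log ‖φ z‖ := by
  have hd : DifferentiableOn ℂ (logDeriv φ) (Metric.ball c R) := by
    intro z hz
    exact ((hφ.deriv z).div (hφ z) (h0 z hz)).differentiableWithinAt
  have hc : c ∈ Metric.ball c R := Metric.mem_ball_self hR
  obtain ⟨L, hLc, hL⟩ := hd.isExactOn_ball.with_val_at c (Complex.log (φ c))
  refine ⟨L, fun z hz => ⟨hL z hz, ?_⟩⟩
  have hder : ∀ w ∈ Metric.ball c R, HasDerivAt (fun w => Complex.exp (-L w) * φ w) 0 w := by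
    intro w hw
    have h1 : HasDerivAt (fun w => Complex.exp (-L w) * φ w) _ w :=
      (((hL w hw).neg).cexp).mul (hφ w).hasDerivAt
    have h2 := h0 w hw
    refine h1.congr_deriv ?_
    rw [logDeriv_apply]
    field_simp
    simp
  have hconst : Complex.exp (-L z) * φ z = Complex.exp (-L c) * φ c :=
    (convex_ball c R).is_const_of_fderivWithin_eq_zero (𝕜 := ℂ)
      (fun w hw => (hder w hw).differentiableAt.differentiableWithinAt)
      (fun w hw => by
        rw [fderivWithin_of_isOpen Metric.isOpen_ball hw]
        ext
        simp [(hder w hw).deriv]) hz hc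
  rw [hLc, Complex.exp_neg, Complex.exp_neg, Complex.exp_log (h0 c hc),
    inv_mul_cancel₀ (h0 c hc)] at hconst
  have h3 : φ z = Complex.exp (L z) := by
    have := Complex.exp_ne_zero (L z)
    field_simp at hconst
    exact hconst
  rw [h3, Complex.norm_exp, Real.log_exp]

/-- The Cayley transform centred at `a` maps the right half-plane into the unit disc. -/
theorem norm_cayley_le_one {w a : ℂ} (hw : 0 < w.re) (ha : 0 < a.re) :
    ‖(w - a) / (w + (starRingEnd ℂ) a)‖ ≤ 1 := by
  rw [norm_div]
  apply div_le_one_of_le₀ _ (norm_nonneg _)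
  apply le_of_sq_le_sq _ (norm_nonneg _)
  rw [Complex.sq_norm, Complex.sq_norm, Complex.normSq_apply, Complex.normSq_apply]
  simp
  nlinarith [mul_pos hw ha]

section Harnack

variable {L : ℂ → ℂ} {c : ℂ} {R : ℝ}

theorem add_conj_ne_zero {w a : ℂ} (hw : 0 < w.re) (ha : 0 < a.re) :
    w + (starRingEnd ℂ) a ≠ 0 := by
  intro h
  have := congrArg Complex.re h
  simp at this
  linarith

/-- Harnack's inequality for the positive harmonic function `Re L`, obtained from the Schwarz lemma
for the Cayley transform of `L`. -/
theorem harnack_lower (hR : 0 < R) (hL : DifferentiableOn ℂ L (Metric.ball c R))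
    (hpos : ∀ z ∈ Metric.ball c R, 0 < (L z).re) {z : ℂ} (hz : z ∈ Metric.ball c R) :
    (L c).re * (R - ‖z - c‖) ≤ (L z).re * (R + ‖z - c‖) := by
  have hc : c ∈ Metric.ball c R := Metric.mem_ball_self hR
  have hψ : DifferentiableOn ℂ (fun z => (L z - L c) / (L z + (starRingEnd ℂ) (L c)))
      (Metric.ball c R) :=
    (hL.sub_const _).div (hL.add_const _) fun w hw => add_conj_ne_zero (hpos w hw) (hpos c hc)
  have h := Complex.dist_le_div_mul_dist_of_mapsTo_ball (R₂ := 1) hψ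
    (fun w hw => by simpa using norm_cayley_le_one (hpos w hw) (hpos c hc)) hz
  simp only [sub_self, zero_div, dist_zero_right] at h
  have hz' : ‖z - c‖ < R := by simpa [dist_eq_norm] using hz
  rw [norm_div, div_le_iff₀ (norm_pos_iff.mpr (add_conj_ne_zero (hpos z hz) (hpos c hc))),
    dist_eq_norm] at h
  set ρ := ‖z - c‖ with hρ
  have hρ0 : 0 ≤ ρ := norm_nonneg _
  have h1 : R * ‖L z - L c‖ ≤ ρ * ‖L z + (starRingEnd ℂ) (L c)‖ := by
    have := mul_le_mul_of_nonneg_left h hR.le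
    calc _ ≤ _ := this
      _ = _ := by field_simp
  have h2 : (R * ‖L z - L c‖) ^ 2 ≤ (ρ * ‖L z + (starRingEnd ℂ) (L c)‖) ^ 2 := by gcongr
  rw [mul_pow, mul_pow, Complex.sq_norm (L z - L c), Complex.sq_norm (L z + _),
    Complex.normSq_apply, Complex.normSq_apply] at h2
  simp only [Complex.sub_re, Complex.sub_im, Complex.add_re, Complex.add_im, Complex.conj_re,
    Complex.conj_im] at h2
  have hx := hpos z hz
  have ha := hpos c hc
  -- The imaginary parts contribute with a favourable sign, as `ρ ≤ R`.
  have h3 : (R * ((L c).re - (L z).re)) ^ 2 ≤ (ρ * ((L z).re + (L c).re)) ^ 2 := by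
    have : ρ ^ 2 ≤ R ^ 2 := by gcongr
    nlinarith [mul_nonneg (sub_nonneg.mpr this) (sq_nonneg ((L z).im - (L c).im))]
  have h4 := abs_le_of_sq_le_sq h3 (by positivity)
  have := (abs_le.mp h4).2
  linarith

/-- The gradient estimate for positive harmonic functions at the centre of a disc. -/
theorem norm_deriv_le_of_re_pos (hR : 0 < R) (hL : DifferentiableOn ℂ L (Metric.ball c R))
    (hpos : ∀ z ∈ Metric.ball c R, 0 < (L z).re) :
    ‖deriv L c‖ ≤ 2 * (L c).re / R := by
  have hc : c ∈ Metric.ball c R := Metric.mem_ball_self hR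
  have hψ : DifferentiableOn ℂ (fun z => (L z - L c) / (L z + (starRingEnd ℂ) (L c)))
      (Metric.ball c R) :=
    (hL.sub_const _).div (hL.add_const _) fun w hw => add_conj_ne_zero (hpos w hw) (hpos c hc)
  have h := Complex.norm_deriv_le_div_of_mapsTo_ball (R₂ := 1) hψ
    (fun w hw => by simpa using norm_cayley_le_one (hpos w hw) (hpos c hc)) hR
  have hLd : HasDerivAt L (deriv L c) c :=
    (hL.differentiableAt (Metric.isOpen_ball.mem_nhds hc)).hasDerivAt
  have hne := add_conj_ne_zero (hpos c hc) (hpos c hc)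
  have hd : HasDerivAt (fun z => (L z - L c) / (L z + (starRingEnd ℂ) (L c))) _ c :=
    (hLd.sub_const (L c)).div (hLd.add_const ((starRingEnd ℂ) (L c))) hne
  rw [hd.deriv] at h
  have e : L c + (starRingEnd ℂ) (L c) = ((2 * (L c).re : ℝ) : ℂ) := Complex.add_conj _
  have hp : (0 : ℝ) < 2 * (L c).re := by linarith [hpos c hc]
  rw [sub_self, zero_mul, sub_zero, norm_div, norm_mul, norm_pow, e, Complex.norm_real,
    Real.norm_of_nonneg hp.le, pow_two, mul_div_mul_right _ _ hp.ne', div_le_iff₀ hp] at h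
  calc _ ≤ _ := h
    _ = _ := by ring

end Harnack

theorem norm_logDeriv_le_of_one_lt {φ : ℂ → ℂ} (hφ : Differentiable ℂ φ) {c : ℂ} {R : ℝ}
    (hR : 0 < R) (h1 : ∀ z ∈ Metric.ball c R, 1 < ‖φ z‖) :
    ‖logDeriv φ c‖ ≤ 2 * Real.log ‖φ c‖ / R := by
  have hc : c ∈ Metric.ball c R := Metric.mem_ball_self hR
  obtain ⟨L, hL⟩ := exists_holomorphic_log hφ hR
    (fun z hz h => by have := h1 z hz; rw [h, norm_zero] at this; linarith)
  rw [← (hL c hc).1.deriv, ← (hL c hc).2]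
  exact norm_deriv_le_of_re_pos hR (fun z hz => (hL z hz).1.differentiableAt.differentiableWithinAt)
    (fun z hz => by rw [(hL z hz).2]; exact Real.log_pos (h1 z hz))

/-- A boundary point lemma of Hopf type. If `log |φ|` is positive on a disc of radius `R` and vanishes
at a boundary point `z₁`, Harnack's inequality forces it to grow at least linearly from `z₁`
towards the centre, so that its value there is controlled by its gradient at `z₁`. -/
theorem log_norm_le_of_touching {φ : ℂ → ℂ} (hφ : Differentiable ℂ φ) {c z₁ : ℂ} {R : ℝ}
    (hR : 0 < R) (h1 : ∀ z ∈ Metric.ball c R, 1 < ‖φ z‖) (hz₁ : ‖z₁ - c‖ = R)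
    (ht : ‖φ z₁‖ = 1) :
    Real.log ‖φ c‖ ≤ 2 * R * ‖logDeriv φ z₁‖ := by
  obtain ⟨L, hL⟩ := exists_holomorphic_log hφ hR
    (fun z hz h => by have := h1 z hz; rw [h, norm_zero] at this; linarith)
  have hc : c ∈ Metric.ball c R := Metric.mem_ball_self hR
  have hne : φ z₁ ≠ 0 := by intro h; rw [h, norm_zero] at ht; linarith
  -- `ψ` is `log φ` near `z₁`, normalised so that the principal branch is available.
  set ψ : ℂ → ℂ := fun z => Complex.log (φ z / φ z₁) with hψ
  have hψd : HasDerivAt ψ (logDeriv φ z₁) z₁ := by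
    have := ((hφ z₁).hasDerivAt.div_const (φ z₁)).clog (by simp [div_self hne])
    simpa [div_self hne, logDeriv_apply] using this
  have hγ : HasDerivAt (fun t : ℝ => z₁ + (t : ℂ) * (c - z₁)) (c - z₁) 0 := by
    have := (((hasDerivAt_id (0 : ℝ)).ofReal_comp).mul_const (c - z₁)).const_add z₁
    simpa using this
  have hcomp : HasDerivAt (fun t : ℝ => ψ (z₁ + (t : ℂ) * (c - z₁)))
      (logDeriv φ z₁ * (c - z₁)) 0 :=
    HasDerivAt.comp (0 : ℝ) (h₂ := ψ) (h := fun t : ℝ => z₁ + (t : ℂ) * (c - z₁))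
      (by simpa using hψd) hγ
  have hre : HasDerivAt (fun t : ℝ => (ψ (z₁ + (t : ℂ) * (c - z₁))).re)
      (logDeriv φ z₁ * (c - z₁)).re 0 := by
    exact Complex.reCLM.hasFDerivAt.comp_hasDerivAt (0 : ℝ) hcomp
  have hval : ∀ z, (ψ z).re = Real.log ‖φ z‖ := by
    intro z
    simp [hψ, Complex.log_re, ht]
  have hlim := hre.tendsto_slope_zero_right
  have hlow : ∀ᶠ t : ℝ in 𝓝[>] 0, Real.log ‖φ c‖ / 2 ≤
      t⁻¹ • ((ψ (z₁ + ((0 + t : ℝ) : ℂ) * (c - z₁))).re -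
        (ψ (z₁ + ((0 : ℝ) : ℂ) * (c - z₁))).re) := by
    filter_upwards [Ioo_mem_nhdsGT (show (0 : ℝ) < 1 by norm_num)] with t ht'
    obtain ⟨ht0, ht1⟩ := ht'
    rw [hval, hval]
    have e : z₁ + ((0 + t : ℝ) : ℂ) * (c - z₁) - c = ((1 - t : ℝ) : ℂ) * (z₁ - c) := by
      push_cast; ring
    have en : ‖z₁ + ((0 + t : ℝ) : ℂ) * (c - z₁) - c‖ = (1 - t) * R := by
      rw [e, norm_mul, Complex.norm_real, Real.norm_of_nonneg (by linarith), hz₁]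
    have hmem : z₁ + ((0 + t : ℝ) : ℂ) * (c - z₁) ∈ Metric.ball c R := by
      rw [Metric.mem_ball, dist_eq_norm, en]; nlinarith
    have := harnack_lower hR
      (fun z hz => (hL z hz).1.differentiableAt.differentiableWithinAt)
      (fun z hz => by rw [(hL z hz).2]; exact Real.log_pos (h1 z hz)) hmem
    rw [(hL c hc).2, (hL _ hmem).2, en] at this
    simp only [Complex.ofReal_zero, zero_mul, add_zero, ht, Real.log_one, sub_zero, smul_eq_mul]
    have hlogc := Real.log_pos (h1 c hc)
    have hlogt := Real.log_pos (h1 _ hmem)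
    set A := Real.log ‖φ c‖
    set B := Real.log ‖φ (z₁ + ((0 + t : ℝ) : ℂ) * (c - z₁))‖
    rw [← div_eq_inv_mul, le_div_iff₀ ht0]
    have h5 : R * (A * t) ≤ R * (B * (2 - t)) := by nlinarith
    have h6 := le_of_mul_le_mul_left h5 hR
    nlinarith [mul_pos hlogt ht0]
  have hle := ge_of_tendsto hlim hlow
  have hn : (logDeriv φ z₁ * (c - z₁)).re ≤ ‖logDeriv φ z₁‖ * R := by
    calc _ ≤ ‖logDeriv φ z₁ * (c - z₁)‖ := Complex.re_le_norm _
      _ = _ := by rw [norm_mul, norm_sub_rev, hz₁]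
  linarith

/-! ### Eliminating one function from a family with comparable logarithmic derivatives -/

/-- At every point where `G i` and `G j` both realise the maximum of `|G k|` over `k ∈ S`, the
gradient of `log |G i / G j|`, expressed through logarithmic derivatives, is at most
`C (1 + |z|) ^ τ`. At points with a single maximal function nothing is required. -/
def TieBound {ι : Type*} (τ C : ℝ) (G : ι → ℂ → ℂ) (S : Finset ι) : Prop :=
  ∀ z, ∀ i ∈ S, ∀ j ∈ S, (∀ k ∈ S, ‖G k z‖ ≤ ‖G i z‖) → (∀ k ∈ S, ‖G k z‖ ≤ ‖G j z‖) →
    ‖logDeriv (G i) z - logDeriv (G j) z‖ ≤ C * (1 + ‖z‖) ^ τ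

theorem logDeriv_fun_div_eq_sub {f g : ℂ → ℂ} (hf : Differentiable ℂ f) (hg : Differentiable ℂ g)
    {z : ℂ} (hfz : f z ≠ 0) (hgz : g z ≠ 0) :
    logDeriv (fun z => f z / g z) z = logDeriv f z - logDeriv g z :=
  logDeriv_div z hfz hgz (hf z) (hg z)

section Elimination

variable {ι : Type*} {G : ι → ℂ → ℂ} {τ C : ℝ} {S : Finset ι} {a : ι}

/-- The degenerate case of `TieBound.elim`: if `G a` exceeds every other function on the whole plane,
the quotients `G i / G a` are constant by Liouville's theorem. -/
theorem TieBound.of_dominant (hτ : 0 ≤ τ) (hG : Differentiable ℂ (G a))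
    (hGS : ∀ i ∈ S, Differentiable ℂ (G i)) (hne : ∀ i ∈ S, ∀ z, G i z ≠ 0) (hS : S.Nonempty)
    (hdom : ∀ z, ∀ i ∈ S, ‖G i z‖ < ‖G a z‖) :
    ∃ C', 0 ≤ C' ∧ TieBound τ C' G S ∧
      ∀ z, ∃ i ∈ S, ‖G a z‖ ≤ ‖G i z‖ * Real.exp (C' * (1 + ‖z‖) ^ (τ + 1)) := by
  obtain ⟨m, hm⟩ := hS
  have ha0 : ∀ z, G a z ≠ 0 := fun z =>
    norm_pos_iff.mp ((norm_nonneg _).trans_lt (hdom z m hm))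
  have hconst : ∀ i ∈ S, ∃ c : ℂ, c ≠ 0 ∧ ∀ z, G i z = c * G a z := by
    intro i hi
    have hb : Bornology.IsBounded (Set.range fun z => G i z / G a z) := by
      refine (Metric.isBounded_closedBall (x := (0 : ℂ)) (r := 1)).subset ?_
      rintro _ ⟨z, rfl⟩
      rw [mem_closedBall_zero_iff, norm_div]
      exact div_le_one_of_le₀ (hdom z i hi).le (norm_nonneg _)
    refine ⟨G i 0 / G a 0, div_ne_zero (hne i hi 0) (ha0 0), fun z => ?_⟩
    have hz : G i z / G a z = G i 0 / G a 0 :=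
      ((hGS i hi).div hG ha0).apply_eq_apply_of_bounded hb z 0
    rw [← hz, div_mul_cancel₀ _ (ha0 z)]
  have hlog : ∀ i ∈ S, ∀ z, logDeriv (G i) z = logDeriv (G a) z := by
    intro i hi z
    obtain ⟨c, hc, h⟩ := hconst i hi
    rw [funext h]
    exact logDeriv_const_mul z c hc
  obtain ⟨c, hc, h⟩ := hconst m hm
  have hc0 := norm_pos_iff.mpr hc
  refine ⟨|Real.log ‖c‖|, abs_nonneg _, fun z i hi j hj _ _ => ?_, fun z => ⟨m, hm, ?_⟩⟩
  · rw [hlog i hi, hlog j hj, sub_self, norm_zero]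
    positivity
  · rw [h z, norm_mul, mul_comm ‖c‖, mul_assoc]
    refine le_mul_of_one_le_right (norm_nonneg _) ?_
    rw [← Real.exp_log hc0, ← Real.exp_add, Real.log_exp]
    apply Real.one_le_exp
    have h1 : 1 ≤ (1 + ‖z‖) ^ (τ + 1) :=
      Real.one_le_rpow (by linarith [norm_nonneg z]) (by linarith)
    nlinarith [neg_abs_le (Real.log ‖c‖), abs_nonneg (Real.log ‖c‖)]

/-- Removing one function from a family with controlled ties. The removed function `G a` may have
zeros; it exceeds the maximum of the others by at most an exponential factor, and the ties of the
remaining family are still controlled, with a larger constant. -/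
theorem TieBound.elim (hτ : 0 ≤ τ) (hC : 0 ≤ C) (hG : Differentiable ℂ (G a))
    (hGS : ∀ i ∈ S, Differentiable ℂ (G i)) (hne : ∀ i ∈ S, ∀ z, G i z ≠ 0) (hS : S.Nonempty)
    (ha : a ∉ S) (h : TieBound τ C G (S.cons a ha)) :
    ∃ C', 0 ≤ C' ∧ TieBound τ C' G S ∧
      ∀ z, ∃ i ∈ S, ‖G a z‖ ≤ ‖G i z‖ * Real.exp (C' * (1 + ‖z‖) ^ (τ + 1)) := by
  -- Off the closed set `E` the function `G a` alone is maximal.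
  set E : Set ℂ := {z | ∃ i ∈ S, ‖G a z‖ ≤ ‖G i z‖} with hE
  have hEc : IsClosed E := by
    have : E = ⋃ i ∈ S, {z | ‖G a z‖ ≤ ‖G i z‖} := by ext; simp [hE]
    rw [this]
    exact S.finite_toSet.isClosed_biUnion fun i hi =>
      isClosed_le hG.continuous.norm (hGS i hi).continuous.norm
  rcases E.eq_empty_or_nonempty with hemp | ⟨e, he⟩
  · refine TieBound.of_dominant hτ hG hGS hne hS fun z i hi => ?_
    by_contra! hcon
    exact hemp.le (show z ∈ E from ⟨i, hi, hcon⟩)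
  -- The disc about `z₀` up to `E`. Its radius is at most the distance to the fixed point `e`, so that
  -- `1 + ‖z₁‖` is at most `2 + ‖e‖` times `1 + ‖z₀‖` for a touching point `z₁`.
  have key : ∀ z₀ ∉ E, ∃ R, 0 < R ∧ R ≤ (1 + ‖e‖) * (1 + ‖z₀‖) ∧
      (∀ z ∈ Metric.ball z₀ R, ∀ i ∈ S, ‖G i z‖ < ‖G a z‖) ∧
      ∃ k ∈ S, Real.log ‖G a z₀ / G k z₀‖ ≤
        2 * R * (C * (2 + ‖e‖) ^ τ * (1 + ‖z₀‖) ^ τ) := by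
    intro z₀ hz₀
    obtain ⟨z₁, hz₁E, hz₁⟩ := hEc.exists_infDist_eq_dist ⟨e, he⟩ z₀
    have hR : 0 < dist z₀ z₁ := dist_pos.mpr fun h => hz₀ (h ▸ hz₁E)
    have hball : ∀ z ∈ Metric.ball z₀ (dist z₀ z₁), ∀ i ∈ S, ‖G i z‖ < ‖G a z‖ := by
      intro z hz i hi
      by_contra! hcon
      have h1 : Metric.infDist z₀ E ≤ dist z₀ z := Metric.infDist_le_dist_of_mem ⟨i, hi, hcon⟩
      rw [hz₁, dist_comm z₀ z] at h1
      exact absurd (Metric.mem_ball.mp hz) (not_lt.mpr h1)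
    have hRe : dist z₀ z₁ ≤ ‖z₀‖ + ‖e‖ := by
      rw [← hz₁]
      exact (Metric.infDist_le_dist_of_mem he).trans (dist_le_norm_add_norm _ _)
    have hz₁n : ‖z₁‖ ≤ ‖z₀‖ + dist z₀ z₁ := by
      have := norm_add_le z₀ (z₁ - z₀)
      rwa [add_sub_cancel, ← dist_eq_norm, dist_comm] at this
    have hcl : ∀ i ∈ S, ‖G i z₁‖ ≤ ‖G a z₁‖ := by
      intro i hi
      have hmem : z₁ ∈ closure (Metric.ball z₀ (dist z₀ z₁)) := by
        rw [closure_ball _ hR.ne', Metric.mem_closedBall, dist_comm]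
      exact closure_minimal (fun z hz => (hball z hz i hi).le)
        (isClosed_le (hGS i hi).continuous.norm hG.continuous.norm) hmem
    obtain ⟨k, hk, hka⟩ := hz₁E
    have heq : ‖G a z₁‖ = ‖G k z₁‖ := le_antisymm hka (hcl k hk)
    have hmax : ∀ j ∈ S.cons a ha, ‖G j z₁‖ ≤ ‖G a z₁‖ := by
      intro j hj
      rcases Finset.mem_cons.mp hj with rfl | hj
      · exact le_rfl
      · exact hcl j hj
    have hk0 := hne k hk
    have ha1 : G a z₁ ≠ 0 := by
      rw [← norm_ne_zero_iff, heq, norm_ne_zero_iff]; exact hk0 z₁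
    have hφ : Differentiable ℂ (fun z => G a z / G k z) := hG.div (hGS k hk) hk0
    refine ⟨dist z₀ z₁, hR, ?_, hball, k, hk, ?_⟩
    · nlinarith [norm_nonneg z₀, norm_nonneg e, mul_nonneg (norm_nonneg z₀) (norm_nonneg e)]
    · have ht := log_norm_le_of_touching hφ hR (fun z hz => by
        rw [norm_div, one_lt_div (norm_pos_iff.mpr (hk0 z))]
        exact hball z hz k hk) (z₁ := z₁) (by rw [← dist_eq_norm, dist_comm])
        (by rw [norm_div, heq, div_self (norm_ne_zero_iff.mpr (hk0 z₁))])
      rw [logDeriv_fun_div_eq_sub hG (hGS k hk) ha1 (hk0 z₁)] at ht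
      refine ht.trans ?_
      gcongr
      refine (h z₁ a (by simp) k (by simp [hk]) hmax (heq ▸ hmax)).trans ?_
      rw [mul_assoc, ← Real.mul_rpow (by positivity) (by positivity)]
      gcongr
      nlinarith [norm_nonneg z₀, norm_nonneg e, mul_nonneg (norm_nonneg z₀) (norm_nonneg e)]
  set C₁ := C * (2 + ‖e‖) ^ τ with hC₁
  have hC₁0 : 0 ≤ C₁ := by positivity
  have hC₁C : C ≤ C₁ :=
    le_mul_of_one_le_right hC (Real.one_le_rpow (by linarith [norm_nonneg e]) hτ)
  refine ⟨8 * C₁ + 2 * (1 + ‖e‖) * C₁, by positivity, ?_, ?_⟩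
  · intro z₀ i hi j hj hmi hmj
    have hle : C₁ * (1 + ‖z₀‖) ^ τ ≤ (8 * C₁ + 2 * (1 + ‖e‖) * C₁) * (1 + ‖z₀‖) ^ τ := by
      gcongr
      nlinarith [mul_nonneg (norm_nonneg e) hC₁0]
    by_cases hz₀ : z₀ ∈ E
    · obtain ⟨m, hm, hma⟩ := hz₀
      have hmax : ∀ l ∈ S, (∀ k ∈ S, ‖G k z₀‖ ≤ ‖G l z₀‖) →
          ∀ k ∈ S.cons a ha, ‖G k z₀‖ ≤ ‖G l z₀‖ := by
        intro l _ hml k hk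
        rcases Finset.mem_cons.mp hk with rfl | hk
        · exact hma.trans (hml m hm)
        · exact hml k hk
      refine (h z₀ i (by simp [hi]) j (by simp [hj]) (hmax i hi hmi) (hmax j hj hmj)).trans
        (le_trans ?_ hle)
      gcongr
    · obtain ⟨R, hR, -, hball, k, hk, hlog⟩ := key z₀ hz₀
      have hz₀b : z₀ ∈ Metric.ball z₀ R := Metric.mem_ball_self hR
      have ha0 : G a z₀ ≠ 0 := by
        rw [← norm_pos_iff]
        exact (norm_nonneg _).trans_lt (hball z₀ hz₀b k hk)
      have hb : ∀ l ∈ S, (∀ k ∈ S, ‖G k z₀‖ ≤ ‖G l z₀‖) →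
          ‖logDeriv (G a) z₀ - logDeriv (G l) z₀‖ ≤ 4 * (C₁ * (1 + ‖z₀‖) ^ τ) := by
        intro l hl hml
        have hl0 := hne l hl
        have hφ : Differentiable ℂ (fun z => G a z / G l z) := hG.div (hGS l hl) hl0
        have ht := norm_logDeriv_le_of_one_lt hφ hR (fun z hz => by
          rw [norm_div, one_lt_div (norm_pos_iff.mpr (hl0 z))]
          exact hball z hz l hl)
        rw [logDeriv_fun_div_eq_sub hG (hGS l hl) ha0 (hl0 z₀)] at ht
        refine ht.trans ?_
        -- `G l` is maximal in `S` at `z₀`, so the bound for `G a / G k` holds for `G a / G l` as well.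
        have hlk : Real.log ‖G a z₀ / G l z₀‖ ≤ Real.log ‖G a z₀ / G k z₀‖ := by
          apply Real.log_le_log (norm_pos_iff.mpr (div_ne_zero ha0 (hl0 z₀)))
          rw [norm_div, norm_div]
          have := norm_pos_iff.mpr (hne k hk z₀)
          have := hml k hk
          gcongr
        rw [div_le_iff₀ hR]
        linarith
      calc ‖logDeriv (G i) z₀ - logDeriv (G j) z₀‖
          = ‖(logDeriv (G a) z₀ - logDeriv (G j) z₀) -
              (logDeriv (G a) z₀ - logDeriv (G i) z₀)‖ := by congr 1; ring
        _ ≤ 4 * (C₁ * (1 + ‖z₀‖) ^ τ) + 4 * (C₁ * (1 + ‖z₀‖) ^ τ) :=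
          (norm_sub_le _ _).trans (add_le_add (hb j hj hmj) (hb i hi hmi))
        _ = 8 * C₁ * (1 + ‖z₀‖) ^ τ := by ring
        _ ≤ _ := by
          gcongr
          have : 0 ≤ 2 * (1 + ‖e‖) * C₁ := by positivity
          linarith
  · intro z₀
    by_cases hz₀ : z₀ ∈ E
    · obtain ⟨m, hm, hma⟩ := hz₀
      refine ⟨m, hm, hma.trans (le_mul_of_one_le_right (norm_nonneg _) ?_)⟩
      exact Real.one_le_exp (by positivity)
    · obtain ⟨R, hR, hRle, hball, k, hk, hlog⟩ := key z₀ hz₀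
      refine ⟨k, hk, ?_⟩
      have hk0 := norm_pos_iff.mpr (hne k hk z₀)
      have ha0 : 0 < ‖G a z₀‖ := hk0.trans (hball z₀ (Metric.mem_ball_self hR) k hk)
      rw [norm_div, Real.log_le_iff_le_exp (by positivity), div_le_iff₀ hk0, mul_comm] at hlog
      refine hlog.trans (mul_le_mul_of_nonneg_left (Real.exp_le_exp.mpr ?_) hk0.le)
      rw [Real.rpow_add (by positivity), Real.rpow_one]
      have h1 : 2 * R * (C₁ * (1 + ‖z₀‖) ^ τ) ≤
          2 * ((1 + ‖e‖) * (1 + ‖z₀‖)) * (C₁ * (1 + ‖z₀‖) ^ τ) := by gcongr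
      have h2 : 0 ≤ 8 * C₁ * ((1 + ‖z₀‖) ^ τ * (1 + ‖z₀‖)) := by positivity
      nlinarith

theorem norm_le_mul_exp_of_mem_cons {C₁ C₂ : ℝ} {k : ι} (hC₁ : 0 ≤ C₁) (ha : a ∉ S)
    (hle : ∀ z, ∃ i ∈ S, ‖G a z‖ ≤ ‖G i z‖ * Real.exp (C₁ * (1 + ‖z‖) ^ (τ + 1)))
    (hk' : ∀ z, ∀ i ∈ S, ‖G i z‖ ≤ ‖G k z‖ * Real.exp (C₂ * (1 + ‖z‖) ^ (τ + 1))) :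
    ∀ z, ∀ i ∈ S.cons a ha,
      ‖G i z‖ ≤ ‖G k z‖ * Real.exp ((C₁ + C₂) * (1 + ‖z‖) ^ (τ + 1)) := by
  intro z i hi
  have hz : 0 ≤ (1 + ‖z‖) ^ (τ + 1) := by positivity
  have he : Real.exp ((C₁ + C₂) * (1 + ‖z‖) ^ (τ + 1)) =
    Real.exp (C₂ * (1 + ‖z‖) ^ (τ + 1)) * Real.exp (C₁ * (1 + ‖z‖) ^ (τ + 1)) := by
    rw [← Real.exp_add]; ring_nf
  rw [he, ← mul_assoc]
  rcases Finset.mem_cons.mp hi with rfl | hi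
  · obtain ⟨j, hj, hj'⟩ := hle z
    exact hj'.trans (mul_le_mul_of_nonneg_right (hk' z j hj) (Real.exp_nonneg _))
  · exact (hk' z i hi).trans (le_mul_of_one_le_right (by positivity)
      (Real.one_le_exp (by positivity)))

/-- Removing zero-free functions one after the other leaves a single one, which dominates all up to an
exponential factor. -/
theorem TieBound.exists_dominating (hτ : 0 ≤ τ) (hC : 0 ≤ C) (hS : S.Nonempty)
    (hGS : ∀ i ∈ S, Differentiable ℂ (G i)) (hne : ∀ i ∈ S, ∀ z, G i z ≠ 0)
    (h : TieBound τ C G S) :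
    ∃ C', 0 ≤ C' ∧ ∃ k ∈ S, ∀ z, ∀ i ∈ S,
      ‖G i z‖ ≤ ‖G k z‖ * Real.exp (C' * (1 + ‖z‖) ^ (τ + 1)) := by
  induction hS using Finset.Nonempty.cons_induction generalizing C with
  | singleton a =>
    refine ⟨0, le_rfl, a, by simp, fun z i hi => ?_⟩
    rw [Finset.mem_singleton.mp hi]
    simp
  | cons a S ha hS ih =>
    have hGS' : ∀ i ∈ S, Differentiable ℂ (G i) := fun i hi => hGS i (by simp [hi])
    have hne' : ∀ i ∈ S, ∀ z, G i z ≠ 0 := fun i hi => hne i (by simp [hi])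
    obtain ⟨C₁, hC₁, hT, hle⟩ := h.elim hτ hC (hGS a (by simp)) hGS' hne' hS
    obtain ⟨C₂, hC₂, k, hk, hk'⟩ := ih hC₁ hGS' hne' hT
    exact ⟨C₁ + C₂, by positivity, k, by simp [hk],
      norm_le_mul_exp_of_mem_cons hC₁ ha hle hk'⟩

end Elimination

/-! ### Pulling back by a power map -/

section Growth

variable {ι : Type*} {G : ι → ℂ → ℂ} {τ C : ℝ} {S : Finset ι} {a : ι}

/-- A family without common zeros in which at most `G a` has zeros is dominated by a zero-free
member. -/
theorem TieBound.exists_dominating_cons (hτ : 0 ≤ τ) (hC : 0 ≤ C) (hG : Differentiable ℂ (G a))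
    (hGS : ∀ i ∈ S, Differentiable ℂ (G i)) (hne : ∀ i ∈ S, ∀ z, G i z ≠ 0)
    (ha : a ∉ S) (hzero : ∀ z, ∃ i ∈ S.cons a ha, G i z ≠ 0)
    (h : TieBound τ C G (S.cons a ha)) :
    ∃ C', 0 ≤ C' ∧ ∃ k ∈ S.cons a ha, (∀ z, G k z ≠ 0) ∧ ∀ z, ∀ i ∈ S.cons a ha,
      ‖G i z‖ ≤ ‖G k z‖ * Real.exp (C' * (1 + ‖z‖) ^ (τ + 1)) := by
  rcases S.eq_empty_or_nonempty with rfl | hS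
  · refine ⟨0, le_rfl, a, by simp, fun z => ?_, fun z i hi => ?_⟩
    · obtain ⟨i, hi, hi0⟩ := hzero z
      have : i = a := by simpa using hi
      exact this ▸ hi0
    · have : i = a := by simpa using hi
      simp [this]
  · obtain ⟨C₁, hC₁, hT, hle⟩ := h.elim hτ hC hG hGS hne hS
    obtain ⟨C₂, hC₂, k, hk, hk'⟩ := hT.exists_dominating hτ hC₁ hS hGS hne
    exact ⟨C₁ + C₂, by positivity, k, by simp [hk], hne k hk,
      norm_le_mul_exp_of_mem_cons hC₁ ha hle hk'⟩

/-- The pullback of `h(z) |dz|` under `z = w ^ n`: growth of order `σ` becomes growth of order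
`n (σ + 1) - 1`, which is nonnegative for large `n`. -/
theorem exists_pow_pullback_bound {h : ℂ → ℝ} (hh : Continuous h) {σ : ℝ}
    (hO : h =O[cocompact ℂ] fun z : ℂ => ‖z‖ ^ σ) {n : ℕ} (hn : n ≠ 0)
    (hτ : 0 ≤ n * (σ + 1) - 1) :
    ∃ C, 0 ≤ C ∧ ∀ z : ℂ, n * ‖z‖ ^ (n - 1) * h (z ^ n) ≤ C * (1 + ‖z‖) ^ (n * (σ + 1) - 1) := by
  obtain ⟨c, hc, hcO⟩ := hO.exists_nonneg
  obtain ⟨R, hR⟩ := Metric.closedBall_compl_subset_of_mem_cocompact hcO.bound 0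
  have hcont : Continuous fun z : ℂ => n * ‖z‖ ^ (n - 1) * h (z ^ n) := by fun_prop
  set R' := max R 1 with hR'
  obtain ⟨B, hB⟩ := (isCompact_closedBall (0 : ℂ) R').exists_bound_of_continuousOn
    hcont.continuousOn
  have hB0 : 0 ≤ B := (norm_nonneg _).trans (hB 0 (by simp [hR']))
  refine ⟨B + n * c, by positivity, fun z => ?_⟩
  have h1 : (1 : ℝ) ≤ (1 + ‖z‖) ^ (n * (σ + 1) - 1) :=
    Real.one_le_rpow (by linarith [norm_nonneg z]) hτ
  by_cases hz : ‖z‖ ≤ R'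
  · calc _ ≤ B := (Real.le_norm_self _).trans (hB z (by simpa using hz))
      _ ≤ B + n * c := by have : 0 ≤ n * c := by positivity
                          linarith
      _ ≤ _ := le_mul_of_one_le_right (by positivity) h1
  · have hz1 : 1 < ‖z‖ := (le_max_right R 1).trans_lt (not_le.mp hz)
    have hz0 : 0 < ‖z‖ := by linarith
    have hzn : ‖z‖ ≤ ‖z ^ n‖ := by
      rw [norm_pow]; exact le_self_pow₀ hz1.le hn
    have hmem : z ^ n ∈ (Metric.closedBall (0 : ℂ) R)ᶜ := by
      simp only [Set.mem_compl_iff, mem_closedBall_zero_iff, not_le]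
      exact (le_max_left R 1).trans_lt ((not_le.mp hz).trans_le hzn)
    have hb : ‖h (z ^ n)‖ ≤ c * ‖‖z ^ n‖ ^ σ‖ := hR hmem
    rw [Real.norm_of_nonneg (by positivity : 0 ≤ ‖z ^ n‖ ^ σ)] at hb
    have he : ‖z‖ ^ (n - 1) * ‖z ^ n‖ ^ σ = ‖z‖ ^ (n * (σ + 1) - 1) := by
      rw [norm_pow, ← Real.rpow_natCast, ← Real.rpow_natCast, ← Real.rpow_mul hz0.le,
        ← Real.rpow_add hz0, Nat.cast_sub (Nat.one_le_iff_ne_zero.mpr hn)]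
      congr 1
      push_cast
      ring
    calc n * ‖z‖ ^ (n - 1) * h (z ^ n) ≤ n * ‖z‖ ^ (n - 1) * (c * ‖z ^ n‖ ^ σ) := by
          gcongr
          exact (Real.le_norm_self _).trans hb
      _ = n * c * ‖z‖ ^ (n * (σ + 1) - 1) := by rw [← he]; ring
      _ ≤ (B + n * c) * (1 + ‖z‖) ^ (n * (σ + 1) - 1) := by
          gcongr <;> linarith

/-- The growth estimate for a family with controlled ties, for every order `σ > -1`. -/
theorem exists_dominating_of_isBigO {h : ℂ → ℝ} (hh : Continuous h) {σ : ℝ} (hσ : -1 < σ)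
    (hO : h =O[cocompact ℂ] fun z : ℂ => ‖z‖ ^ σ) (hG : Differentiable ℂ (G a))
    (hGS : ∀ i ∈ S, Differentiable ℂ (G i)) (hne : ∀ i ∈ S, ∀ z, G i z ≠ 0)
    (ha : a ∉ S) (hzero : ∀ z, ∃ i ∈ S.cons a ha, G i z ≠ 0)
    (htie : ∀ z, ∀ i ∈ S.cons a ha, ∀ j ∈ S.cons a ha,
      (∀ k ∈ S.cons a ha, ‖G k z‖ ≤ ‖G i z‖) → (∀ k ∈ S.cons a ha, ‖G k z‖ ≤ ‖G j z‖) →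
        ‖logDeriv (G i) z - logDeriv (G j) z‖ ≤ h z) :
    ∃ C, 0 ≤ C ∧ ∃ k ∈ S.cons a ha, (∀ z, G k z ≠ 0) ∧ ∀ z, ∀ i ∈ S.cons a ha,
      ‖G i z‖ ≤ ‖G k z‖ * Real.exp (C * (1 + ‖z‖) ^ (σ + 1)) := by
  have hσ' : 0 < σ + 1 := by linarith
  obtain ⟨n, hn⟩ := exists_nat_ge (1 / (σ + 1))
  have hn1 : 1 ≤ n * (σ + 1) := by rwa [div_le_iff₀ hσ'] at hn
  have hn0 : n ≠ 0 := by rintro rfl; norm_num at hn1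
  obtain ⟨C, hC, hbound⟩ := exists_pow_pullback_bound hh hO hn0 (by linarith)
  have hd : ∀ i, Differentiable ℂ (G i) → Differentiable ℂ fun w => G i (w ^ n) :=
    fun i hi => hi.comp (differentiable_pow n)
  have hdS : ∀ i ∈ S.cons a ha, Differentiable ℂ (G i) := by
    intro i hi
    rcases Finset.mem_cons.mp hi with rfl | hi
    exacts [hG, hGS i hi]
  have hT : TieBound (n * (σ + 1) - 1) C (fun i w => G i (w ^ n)) (S.cons a ha) := by
    intro w i hi j hj hmi hmj
    have e : ∀ i ∈ S.cons a ha, logDeriv (fun w => G i (w ^ n)) w =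
        logDeriv (G i) (w ^ n) * (n * w ^ (n - 1)) := by
      intro i hi
      have := logDeriv_comp (f := G i) (g := fun w : ℂ => w ^ n) (x := w) (hdS i hi _)
        (differentiable_pow n w)
      simpa [Function.comp_def] using this
    rw [e i hi, e j hj, ← sub_mul, norm_mul, mul_comm]
    refine le_trans ?_ (hbound w)
    rw [norm_mul, norm_pow, Complex.norm_natCast]
    gcongr
    exact htie _ i hi j hj hmi hmj
  obtain ⟨C', hC', k, hk, -, hle⟩ := hT.exists_dominating_cons (by linarith) hC (hd a hG)
    (fun i hi => hd i (hGS i hi)) (fun i hi w => hne i hi _) ha (fun w => hzero _)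
  have hpow : ∀ z : ℂ, ∃ w : ℂ, w ^ n = z := fun z => IsAlgClosed.exists_pow_nat_eq z
    (Nat.pos_of_ne_zero hn0)
  have hmax : ∀ z, ∀ i ∈ S.cons a ha,
      ‖G i z‖ ≤ ‖G k z‖ * Real.exp (C' * 2 ^ (n * (σ + 1)) * (1 + ‖z‖) ^ (σ + 1)) := by
    intro z i hi
    obtain ⟨w, rfl⟩ := hpow z
    refine (hle w i hi).trans
      (mul_le_mul_of_nonneg_left (Real.exp_le_exp.mpr ?_) (norm_nonneg _))
    rw [mul_assoc, sub_add_cancel]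
    refine mul_le_mul_of_nonneg_left ?_ hC'
    have h1 : 1 + ‖w‖ ≤ 2 * (1 + ‖w ^ n‖) ^ ((n : ℝ)⁻¹) := by
      have hw : ‖w‖ = (‖w ^ n‖) ^ ((n : ℝ)⁻¹) := by
        rw [norm_pow, Real.pow_rpow_inv_natCast (norm_nonneg _) hn0]
      have h2 : ‖w‖ ≤ (1 + ‖w ^ n‖) ^ ((n : ℝ)⁻¹) := by
        conv_lhs => rw [hw]
        gcongr
        linarith
      have h3 : (1 : ℝ) ≤ (1 + ‖w ^ n‖) ^ ((n : ℝ)⁻¹) :=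
        Real.one_le_rpow (by linarith [norm_nonneg (w ^ n)]) (by positivity)
      linarith
    calc (1 + ‖w‖) ^ (n * (σ + 1)) ≤ (2 * (1 + ‖w ^ n‖) ^ ((n : ℝ)⁻¹)) ^ (n * (σ + 1)) := by
          gcongr
      _ = 2 ^ (n * (σ + 1)) * (1 + ‖w ^ n‖) ^ (σ + 1) := by
          rw [Real.mul_rpow (by positivity) (by positivity), ← Real.rpow_mul (by positivity),
            inv_mul_cancel_left₀ (Nat.cast_ne_zero.mpr hn0)]
  refine ⟨_, by positivity, k, hk, fun z hz => ?_, hmax⟩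
  obtain ⟨i, hi, hi0⟩ := hzero z
  have := hmax z i hi
  rw [hz, norm_zero, zero_mul] at this
  exact hi0 (norm_le_zero_iff.mp this)

end Growth

/-! ### Green's formula and integration in polar coordinates -/

/-- Green's formula for `β(z) dz` on the disc of radius `R`, in polar coordinates. The function `r` is
`∂β/∂z̄`. -/
theorem integral_polar_dbar {β p r : ℂ → ℂ} (hβ : Differentiable ℝ β)
    (hD : ∀ z h, fderiv ℝ β z h = p z * h + r z * conj h) (hr : Continuous r) (R : ℝ) :
    ∫ t in (0 : ℝ)..R, ∫ θ in (0 : ℝ)..2 * Real.pi, (2 * t : ℂ) * r (circleMap 0 t θ) =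
      ∫ θ in (0 : ℝ)..2 * Real.pi, circleMap 0 R θ * β (circleMap 0 R θ) := by
  set e : ℝ → ℂ := fun θ => Complex.exp (θ * Complex.I) with he
  set Φ : ℝ × ℝ → ℂ := fun x => x.1 * e x.2 with hΦ
  have hmap : ∀ t θ, circleMap 0 t θ = Φ (t, θ) := by
    intro t θ; simp [circleMap, hΦ, he]
  have hed : Differentiable ℝ e := by
    intro θ
    exact (((hasDerivAt_id θ).ofReal_comp.mul_const Complex.I).cexp).differentiableAt
  have heθ : ∀ θ, HasDerivAt e (e θ * Complex.I) θ := by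
    intro θ
    have := ((hasDerivAt_id θ).ofReal_comp.mul_const Complex.I).cexp
    simpa using this
  have hfst : Differentiable ℝ fun x : ℝ × ℝ => (x.1 : ℂ) :=
    Complex.ofRealCLM.differentiable.comp differentiable_fst
  have hΦd : Differentiable ℝ Φ := hfst.mul (hed.comp differentiable_snd)
  set f : ℝ × ℝ → ℂ := fun x => Φ x * β (Φ x) with hf
  set g : ℝ × ℝ → ℂ := fun x => Complex.I * e x.2 * β (Φ x) with hg
  have hfd : Differentiable ℝ f := hΦd.mul (hβ.comp hΦd)
  have hgd : Differentiable ℝ g :=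
    ((hed.comp differentiable_snd).const_mul Complex.I).mul (hβ.comp hΦd)
  have hunit : ∀ θ, e θ * conj (e θ) = 1 := by
    intro θ
    rw [Complex.mul_conj, Complex.normSq_eq_norm_sq, Complex.norm_exp_ofReal_mul_I]
    simp
  have hft : ∀ t θ, fderiv ℝ f (t, θ) (1, 0) =
      e θ * β (Φ (t, θ)) + Φ (t, θ) * (p (Φ (t, θ)) * e θ + r (Φ (t, θ)) * conj (e θ)) := by
    intro t θ
    have hline : HasDerivAt (fun s : ℝ => (s, θ)) ((1 : ℝ), (0 : ℝ)) t :=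
      (hasDerivAt_id t).prodMk (hasDerivAt_const t θ)
    have h1 := (hfd (t, θ)).hasFDerivAt.comp_hasDerivAt t hline
    have hΦt : HasDerivAt (fun s : ℝ => Φ (s, θ)) (e θ) t := by
      have := (hasDerivAt_id t).ofReal_comp.mul_const (e θ)
      simpa [hΦ] using this
    have h2 := (hβ (Φ (t, θ))).hasFDerivAt.comp_hasDerivAt t hΦt
    rw [hD] at h2
    exact h1.unique (hΦt.mul h2)
  have hgt : ∀ t θ, fderiv ℝ g (t, θ) (0, 1) =
      Complex.I * (e θ * Complex.I) * β (Φ (t, θ)) + Complex.I * e θ *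
        (p (Φ (t, θ)) * (t * (e θ * Complex.I)) +
          r (Φ (t, θ)) * conj (t * (e θ * Complex.I))) := by
    intro t θ
    have hline : HasDerivAt (fun s : ℝ => (t, s)) ((0 : ℝ), (1 : ℝ)) θ :=
      (hasDerivAt_const θ t).prodMk (hasDerivAt_id θ)
    have h1 := (hgd (t, θ)).hasFDerivAt.comp_hasDerivAt θ hline
    have hΦt : HasDerivAt (fun s : ℝ => Φ (t, s)) (t * (e θ * Complex.I)) θ :=
      (heθ θ).const_mul (t : ℂ)
    have h2 := (hβ (Φ (t, θ))).hasFDerivAt.comp_hasDerivAt θ hΦt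
    rw [hD] at h2
    exact h1.unique (((heθ θ).const_mul Complex.I).mul h2)
  -- The terms with `β` and with `p` cancel in the divergence.
  have hsum : ∀ x : ℝ × ℝ, fderiv ℝ f x (1, 0) + fderiv ℝ g x (0, 1) = 2 * x.1 * r (Φ x) := by
    rintro ⟨t, θ⟩
    rw [hft, hgt]
    simp only [map_mul, Complex.conj_ofReal, Complex.conj_I]
    have h1 := hunit θ
    have h2 := Complex.I_mul_I
    have h3 : Φ (t, θ) = t * e θ := rfl
    generalize p (Φ (t, θ)) = P
    generalize r (Φ (t, θ)) = Q
    generalize β (Φ (t, θ)) = B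
    rw [h3]
    linear_combination (2 * t * Q) * h1 + (e θ * B + e θ * e θ * P * t
      - t * Q * e θ * conj (e θ)) * h2
  have key := integral2_divergence_prod_of_hasFDerivAt f g (fderiv ℝ f) (fderiv ℝ g) 0 0 R
    (2 * Real.pi) hfd.continuous.continuousOn hgd.continuous.continuousOn
    (fun x _ => (hfd x).hasFDerivAt) (fun x _ => (hgd x).hasFDerivAt) (by
      simp only [hsum]
      have hc : Continuous fun x : ℝ × ℝ => 2 * (x.1 : ℂ) * r (Φ x) := by
        have := hΦd.continuous
        fun_prop
      exact hc.continuousOn.integrableOn_compact (isCompact_uIcc.prod isCompact_uIcc))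
  simp only [hsum] at key
  have hper : ∀ t : ℝ, g (t, 2 * Real.pi) = g (t, 0) := by
    intro t
    simp [hg, hΦ, he]
  have hzero : ∀ θ : ℝ, f (0, θ) = 0 := by
    intro θ
    simp [hf, hΦ]
  simp only [hper, sub_self, zero_add, hzero, intervalIntegral.integral_zero, sub_zero] at key
  simpa only [hmap] using key

/-- The circle integral of `u - u 0` as an integral of radial derivatives. The function `β` is
`∂u/∂z`. -/
theorem integral_circle_sub_center {u : ℂ → ℝ} {β : ℂ → ℂ} (hu : Differentiable ℝ u)
    (hD : ∀ z h, fderiv ℝ u z h = 2 * (β z * h).re) (hβ : Continuous β) (R : ℝ) :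
    ∫ t in (0 : ℝ)..R, ∫ θ in (0 : ℝ)..2 * Real.pi,
        2 * (Complex.exp (θ * Complex.I) * β (circleMap 0 t θ)).re =
      ∫ θ in (0 : ℝ)..2 * Real.pi, (u (circleMap 0 R θ) - u 0) := by
  have hcm : Continuous fun x : ℝ × ℝ => circleMap 0 x.1 x.2 := by
    unfold circleMap; fun_prop
  have hc : Continuous fun x : ℝ × ℝ =>
      2 * (Complex.exp (x.2 * Complex.I) * β (circleMap 0 x.1 x.2)).re := by
    have := hβ.comp hcm
    fun_prop
  rw [intervalIntegral_intervalIntegral_swap]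
  · refine intervalIntegral.integral_congr fun θ _ => ?_
    have hd : ∀ t : ℝ, HasDerivAt (fun t : ℝ => u (circleMap 0 t θ))
        (2 * (Complex.exp (θ * Complex.I) * β (circleMap 0 t θ)).re) t := by
      intro t
      have hline : HasDerivAt (fun t : ℝ => circleMap 0 t θ) (Complex.exp (θ * Complex.I)) t := by
        have := ((hasDerivAt_id t).ofReal_comp.mul_const (Complex.exp (θ * Complex.I)))
        simpa [circleMap] using this
      have := (hu (circleMap 0 t θ)).hasFDerivAt.comp_hasDerivAt t hline
      rwa [hD, mul_comm (β _)] at this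
    have := intervalIntegral.integral_eq_sub_of_hasDerivAt (a := 0) (b := R) (fun t _ => hd t)
      ((hc.comp (by fun_prop : Continuous fun t : ℝ => (t, θ))).intervalIntegrable _ _)
    simpa using this
  · exact hc.continuousOn.integrableOn_compact (isCompact_uIcc.prod isCompact_uIcc)
      |>.mono_set (Set.prod_mono Set.uIoc_subset_uIcc Set.uIoc_subset_uIcc)

theorem integral_closedBall_eq_polar {h : ℂ → ℝ} (hh : Continuous h) {R : ℝ} (hR : 0 ≤ R) :
    ∫ z in Metric.closedBall (0 : ℂ) R, h z =
      ∫ t in (0 : ℝ)..R, ∫ θ in (0 : ℝ)..2 * Real.pi, t * h (circleMap 0 t θ) := by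
  have hcm : Continuous fun x : ℝ × ℝ => circleMap 0 x.1 x.2 := by
    unfold circleMap; fun_prop
  have hc : Continuous fun x : ℝ × ℝ => x.1 * h (circleMap 0 x.1 x.2) := by
    have := hh.comp hcm
    fun_prop
  have hsymm : ∀ p : ℝ × ℝ, Complex.polarCoord.symm p = circleMap 0 p.1 p.2 := by
    intro p
    rw [Complex.polarCoord_symm_apply, circleMap, Complex.exp_mul_I]
    simp
  rw [← integral_indicator measurableSet_closedBall, ← Complex.integral_comp_polarCoord_symm]
  have hset : (Set.Ioc 0 R ×ˢ Set.Ioo (-Real.pi) Real.pi : Set (ℝ × ℝ)) ⊆ polarCoord.target :=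
    Set.prod_mono Set.Ioc_subset_Ioi_self subset_rfl
  have h1 : ∫ p in polarCoord.target,
      p.1 • (Metric.closedBall (0 : ℂ) R).indicator h (Complex.polarCoord.symm p) =
      ∫ p in Set.Ioc 0 R ×ˢ Set.Ioo (-Real.pi) Real.pi, p.1 * h (circleMap 0 p.1 p.2) := by
    refine (setIntegral_eq_of_subset_of_forall_sdiff_eq_zero
      polarCoord.open_target.measurableSet hset ?_).trans
      (setIntegral_congr_fun (measurableSet_Ioc.prod measurableSet_Ioo) fun p hp => ?_)
    rotate_left
    · have hmem : circleMap 0 p.1 p.2 ∈ Metric.closedBall (0 : ℂ) R := by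
        rw [mem_closedBall_zero_iff, norm_circleMap_zero, abs_of_pos hp.1.1]
        exact hp.1.2
      rw [hsymm, Set.indicator_of_mem hmem, smul_eq_mul]
    · rintro p ⟨hp, hp'⟩
      have hmem : circleMap 0 p.1 p.2 ∉ Metric.closedBall (0 : ℂ) R := by
        rw [mem_closedBall_zero_iff, norm_circleMap_zero, abs_of_pos (show 0 < p.1 from hp.1)]
        exact fun hle => hp' ⟨⟨hp.1, hle⟩, hp.2⟩
      rw [hsymm, Set.indicator_of_notMem hmem, smul_zero]
  rw [h1, Measure.volume_eq_prod, setIntegral_prod _ (by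
    rw [← Measure.volume_eq_prod]
    exact (hc.continuousOn.integrableOn_compact (isCompact_Icc.prod isCompact_Icc)).mono_set
      (Set.prod_mono Set.Ioc_subset_Icc_self Set.Ioo_subset_Icc_self)),
    intervalIntegral.integral_of_le hR]
  refine setIntegral_congr_fun measurableSet_Ioc fun t _ => ?_
  have hper : Function.Periodic (fun θ => t * h (circleMap 0 t θ)) (2 * Real.pi) := fun θ => by
    dsimp only
    rw [periodic_circleMap]
  have := hper.intervalIntegral_add_eq (-Real.pi) 0
  rw [zero_add, show -Real.pi + 2 * Real.pi = Real.pi by ring] at this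
  dsimp only
  rw [← this, intervalIntegral.integral_of_le (by linarith [Real.pi_pos]),
    integral_Ioc_eq_integral_Ioo]

/-! ### The characteristic as a circle average -/

/-- Lagrange's identity for the sum over ordered pairs. -/
theorem sum_norm_sq_wedge {ι : Type*} [Fintype ι] [DecidableEq ι] (a b : ι → ℂ) :
    ((∑ i, ∑ j ∈ Finset.univ.erase i, ‖a i * b j - b i * a j‖ ^ 2 : ℝ) : ℂ) =
      2 * ((∑ i, a i * conj (a i)) * (∑ i, b i * conj (b i)) -
        (∑ i, a i * conj (b i)) * conj (∑ i, a i * conj (b i))) := by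
  have h1 : ∀ i, ∑ j ∈ Finset.univ.erase i, ‖a i * b j - b i * a j‖ ^ 2 =
      ∑ j, ‖a i * b j - b i * a j‖ ^ 2 := by
    intro i
    rw [← Finset.add_sum_erase _ _ (Finset.mem_univ i)]
    simp [mul_comm (a i)]
  simp only [h1]
  push_cast
  have h2 : ∀ i j, ((‖a i * b j - b i * a j‖ : ℝ) : ℂ) ^ 2 =
      (a i * conj (a i)) * (b j * conj (b j)) + (b i * conj (b i)) * (a j * conj (a j))
       - (a i * conj (b i)) * (conj (a j) * b j) - (conj (a i) * b i) * (a j * conj (b j)) := by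
    intro i j
    rw [← Complex.mul_conj', map_sub, map_mul, map_mul]
    ring
  simp only [h2, Finset.sum_sub_distrib, Finset.sum_add_distrib, ← Finset.mul_sum,
    ← Finset.sum_mul, map_sum, map_mul, Complex.conj_conj]
  ring

variable {N : ℕ}

section Jensen

variable {F : Fin (N + 1) → ℂ → ℂ}

/-- The squared Euclidean norm `‖F(z)‖²` of a homogeneous representation. -/
def repNormSq (F : Fin (N + 1) → ℂ → ℂ) (z : ℂ) : ℝ := ∑ j, ‖F j z‖ ^ 2

/-- The Hermitian pairing `⟨F'(z), F(z)⟩`, so that `repPairing F / repNormSq F = ∂ log ‖F‖² / ∂z`. -/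
def repPairing (F : Fin (N + 1) → ℂ → ℂ) (z : ℂ) : ℂ := ∑ j, deriv (F j) z * conj (F j z)

theorem repNormSq_pos (h0 : ∀ z, ∃ j, F j z ≠ 0) (z : ℂ) : 0 < repNormSq F z := by
  obtain ⟨j, hj⟩ := h0 z
  have := norm_pos_iff.mpr hj
  exact Finset.sum_pos' (fun _ _ => by positivity) ⟨j, Finset.mem_univ j, by positivity⟩

theorem ofReal_repNormSq (F : Fin (N + 1) → ℂ → ℂ) (z : ℂ) :
    (repNormSq F z : ℂ) = ∑ j, F j z * conj (F j z) := by
  simp [repNormSq, Complex.mul_conj']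

theorem continuous_repNormSq (hF : ∀ j, Differentiable ℂ (F j)) : Continuous (repNormSq F) :=
  continuous_finsetSum _ fun j _ => (hF j).continuous.norm.pow 2

theorem fsDeriv_nonneg (F : Fin (N + 1) → ℂ → ℂ) (z : ℂ) : 0 ≤ fsDeriv F z :=
  Real.sqrt_nonneg _

theorem fsDeriv_sq (F : Fin (N + 1) → ℂ → ℂ) (z : ℂ) :
    fsDeriv F z ^ 2 =
      (∑ i, ∑ j ∈ Finset.univ.erase i, ‖deriv (F i) z * F j z - F i z * deriv (F j) z‖ ^ 2) /
        repNormSq F z ^ 2 := by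
  rw [fsDeriv, Real.sq_sqrt (by positivity)]
  rfl

theorem continuous_fsDeriv (hF : ∀ j, Differentiable ℂ (F j)) (h0 : ∀ z, ∃ j, F j z ≠ 0) :
    Continuous (fsDeriv F) := by
  have hF1 : ∀ j, Continuous (F j) := fun j => (hF j).continuous
  have hF2 : ∀ j, Continuous (deriv (F j)) := fun j => (hF j).deriv.continuous
  refine (Continuous.div ?_ ((continuous_repNormSq hF).pow 2) fun z =>
    (pow_pos (repNormSq_pos h0 z) 2).ne').sqrt
  fun_prop

theorem hasDerivAt_line {f : ℂ → ℂ} (hf : Differentiable ℂ f) (z h : ℂ) :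
    HasDerivAt (fun s : ℝ => f (z + s • h)) (deriv f z * h) 0 := by
  have hγ : HasDerivAt (fun s : ℝ => z + s • h) h 0 := by
    simpa using ((hasDerivAt_id (0 : ℝ)).smul_const h).const_add z
  exact HasDerivAt.comp (0 : ℝ) (h₂ := f) (h := fun s : ℝ => z + s • h)
    (by simpa using (hf z).hasDerivAt) hγ

theorem differentiable_repNormSq (hF : ∀ j, Differentiable ℂ (F j)) :
    Differentiable ℝ (repNormSq F) :=
  Differentiable.fun_sum fun j _ => ((hF j).restrictScalars ℝ).norm_sq ℝ

theorem differentiable_repPairing (hF : ∀ j, Differentiable ℂ (F j)) :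
    Differentiable ℝ (repPairing F) :=
  Differentiable.fun_sum fun j _ => ((hF j).deriv.restrictScalars ℝ).mul
    (Complex.conjCLE.differentiable.comp ((hF j).restrictScalars ℝ))

theorem hasDerivAt_repNormSq_line (hF : ∀ j, Differentiable ℂ (F j)) (z h : ℂ) :
    HasDerivAt (fun s : ℝ => (repNormSq F (z + s • h) : ℂ))
      (repPairing F z * h + conj (repPairing F z) * conj h) 0 := by
  simp only [ofReal_repNormSq]
  have := HasDerivAt.fun_sum (u := Finset.univ) fun j _ =>
    (hasDerivAt_line (hF j) z h).mul (hasDerivAt_line (hF j) z h).star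
  refine HasDerivAt.congr_deriv this ?_
  simp only [repPairing, map_sum, map_mul, Complex.conj_conj, Finset.sum_mul,
    ← Finset.sum_add_distrib, zero_smul, add_zero]
  refine Finset.sum_congr rfl fun j _ => ?_
  simp
  ring

theorem hasDerivAt_repPairing_line (hF : ∀ j, Differentiable ℂ (F j)) (z h : ℂ) :
    HasDerivAt (fun s : ℝ => repPairing F (z + s • h))
      ((∑ j, deriv (deriv (F j)) z * conj (F j z)) * h +
        (∑ j, deriv (F j) z * conj (deriv (F j) z)) * conj h) 0 := by
  have := HasDerivAt.fun_sum (u := Finset.univ) fun j _ =>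
    (hasDerivAt_line (hF j).deriv z h).mul (hasDerivAt_line (hF j) z h).star
  refine HasDerivAt.congr_deriv this ?_
  simp only [Finset.sum_mul, ← Finset.sum_add_distrib, zero_smul, add_zero]
  refine Finset.sum_congr rfl fun j _ => ?_
  simp
  ring

theorem fderiv_log_repNormSq (hF : ∀ j, Differentiable ℂ (F j)) (h0 : ∀ z, ∃ j, F j z ≠ 0)
    (z h : ℂ) :
    fderiv ℝ (fun z => Real.log (repNormSq F z)) z h =
      2 * (repPairing F z / repNormSq F z * h).re := by
  have hS := repNormSq_pos h0 z
  have hd := (differentiable_repNormSq hF z).hasFDerivAt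
  have h1 : HasDerivAt (fun s : ℝ => repNormSq F (z + s • h))
      (2 * (repPairing F z * h).re) 0 := by
    have := Complex.reCLM.hasFDerivAt.comp_hasDerivAt (0 : ℝ) (hasDerivAt_repNormSq_line hF z h)
    refine HasDerivAt.congr_deriv this ?_
    simp
    ring
  have h2 : fderiv ℝ (repNormSq F) z h = 2 * (repPairing F z * h).re :=
    (hd.hasLineDerivAt h).unique h1
  rw [fderiv.log (differentiable_repNormSq hF z) hS.ne', _root_.smul_apply, h2,
    div_mul_eq_mul_div, Complex.div_ofReal_re, smul_eq_mul]
  ring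

theorem differentiable_repPairing_div (hF : ∀ j, Differentiable ℂ (F j))
    (h0 : ∀ z, ∃ j, F j z ≠ 0) :
    Differentiable ℝ fun z => repPairing F z / (repNormSq F z : ℂ) := by
  have h1 : Differentiable ℝ fun z => (repNormSq F z)⁻¹ :=
    (differentiable_repNormSq hF).inv fun z => (repNormSq_pos h0 z).ne'
  have h : Differentiable ℝ fun z => (((repNormSq F z)⁻¹ : ℝ) : ℂ) :=
    Complex.ofRealCLM.differentiable.comp h1
  simpa only [div_eq_mul_inv, Complex.ofReal_inv] using (differentiable_repPairing hF).fun_mul h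

/-- The derivative of `∂ log ‖F‖² / ∂z`. Its coefficient at `conj h` says that the Laplacian of
`log ‖F‖` is the squared Fubini–Study derivative. -/
theorem fderiv_repPairing_div (hF : ∀ j, Differentiable ℂ (F j)) (h0 : ∀ z, ∃ j, F j z ≠ 0)
    (z h : ℂ) :
    fderiv ℝ (fun z => repPairing F z / repNormSq F z) z h =
      ((∑ j, deriv (deriv (F j)) z * conj (F j z)) / repNormSq F z -
        repPairing F z ^ 2 / repNormSq F z ^ 2) * h + ((fsDeriv F z ^ 2 / 2 : ℝ) : ℂ) * conj h := by
  have hS : (repNormSq F z : ℂ) ≠ 0 := Complex.ofReal_ne_zero.mpr (repNormSq_pos h0 z).ne'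
  have hd := differentiable_repPairing_div hF h0 z
  have h1 := (hasDerivAt_repPairing_line hF z h).div (hasDerivAt_repNormSq_line hF z h)
    (by simpa using hS)
  rw [(hd.hasFDerivAt.hasLineDerivAt h).unique h1, fsDeriv_sq, zero_smul, add_zero]
  have hw := sum_norm_sq_wedge (fun j => deriv (F j) z) (fun j => F j z)
  rw [← ofReal_repNormSq F z, ← repPairing] at hw
  rw [Complex.ofReal_div, Complex.ofReal_div, hw]
  push_cast
  field_simp
  ring

/-- Jensen's formula. The squared Fubini–Study derivative sums over ordered pairs, so the average is
that of `log ‖F‖² = 2 log ‖F‖`. -/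
theorem characteristic_eq_circleAverage (hF : ∀ j, Differentiable ℂ (F j))
    (h0 : ∀ z, ∃ j, F j z ≠ 0) {R : ℝ} (hR : 0 ≤ R) :
    characteristic F R =
      Real.circleAverage (fun z => Real.log (repNormSq F z)) 0 R - Real.log (repNormSq F 0) := by
  set β : ℂ → ℂ := fun z => repPairing F z / repNormSq F z with hβdef
  have hScont := continuous_repNormSq hF
  have hβ : Differentiable ℝ β := differentiable_repPairing_div hF h0
  have hfs := continuous_fsDeriv hF h0
  have hu : Differentiable ℝ fun z => Real.log (repNormSq F z) := fun z =>
    (differentiable_repNormSq hF z).log (repNormSq_pos h0 z).ne'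
  have hcm : ∀ t, Continuous fun θ => circleMap 0 t θ := fun t => continuous_circleMap 0 t
  -- Green's formula for each radius `t > 0`. The factor `t` of `circleMap 0 t θ` cancels `1 / t`.
  have hA : ∀ t : ℝ, 0 < t → 1 / t * (1 / Real.pi *
      ∫ z in Metric.closedBall (0 : ℂ) t, fsDeriv F z ^ 2) =
      1 / (2 * Real.pi) * ∫ θ in (0 : ℝ)..2 * Real.pi,
        2 * (Complex.exp (θ * Complex.I) * β (circleMap 0 t θ)).re := by
    intro t ht
    have h1 := integral_polar_dbar hβ (fderiv_repPairing_div hF h0)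
      (by fun_prop : Continuous fun z => ((fsDeriv F z ^ 2 / 2 : ℝ) : ℂ)) t
    have h2 : ∫ s in (0 : ℝ)..t, ∫ θ in (0 : ℝ)..2 * Real.pi,
        (2 * s : ℂ) * ((fsDeriv F (circleMap 0 s θ) ^ 2 / 2 : ℝ) : ℂ) =
        ((∫ z in Metric.closedBall (0 : ℂ) t, fsDeriv F z ^ 2 : ℝ) : ℂ) := by
      rw [integral_closedBall_eq_polar (h := fun z => fsDeriv F z ^ 2) (hfs.pow 2) ht.le, ← intervalIntegral.integral_ofReal]
      refine intervalIntegral.integral_congr fun s _ => ?_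
      rw [← intervalIntegral.integral_ofReal]
      refine intervalIntegral.integral_congr fun θ _ => ?_
      push_cast
      ring
    have h3 : ∫ θ in (0 : ℝ)..2 * Real.pi, circleMap 0 t θ * β (circleMap 0 t θ) =
        t * ∫ θ in (0 : ℝ)..2 * Real.pi, Complex.exp (θ * Complex.I) * β (circleMap 0 t θ) := by
      rw [← intervalIntegral.integral_const_mul]
      refine intervalIntegral.integral_congr fun θ _ => ?_
      simp [circleMap, mul_assoc]
    have hint : IntervalIntegrable
        (fun θ : ℝ => Complex.exp (θ * Complex.I) * β (circleMap 0 t θ)) volume 0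
          (2 * Real.pi) := by
      have h6 : Continuous fun θ : ℝ => Complex.exp (θ * Complex.I) := by fun_prop
      exact (h6.mul (hβ.continuous.comp (hcm t))).intervalIntegrable _ _
    have h4 : ∫ θ in (0 : ℝ)..2 * Real.pi,
        (Complex.exp (θ * Complex.I) * β (circleMap 0 t θ)).re =
        (∫ θ in (0 : ℝ)..2 * Real.pi, Complex.exp (θ * Complex.I) * β (circleMap 0 t θ)).re :=
      Complex.reCLM.intervalIntegral_comp_comm hint
    have h5 := congrArg Complex.re (h2.symm.trans (h1.trans h3))
    rw [Complex.ofReal_re, Complex.re_ofReal_mul, ← h4] at h5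
    rw [h5, intervalIntegral.integral_const_mul]
    have := Real.pi_pos.ne'
    have := ht.ne'
    generalize ∫ θ in (0 : ℝ)..2 * Real.pi,
      (Complex.exp (θ * Complex.I) * β (circleMap 0 t θ)).re = J
    field_simp
  have hB : characteristic F R = 1 / (2 * Real.pi) * ∫ t in (0 : ℝ)..R,
      ∫ θ in (0 : ℝ)..2 * Real.pi,
        2 * (Complex.exp (θ * Complex.I) * β (circleMap 0 t θ)).re := by
    rw [← intervalIntegral.integral_const_mul, characteristic]
    refine intervalIntegral.integral_congr_ae (Eventually.of_forall fun t ht => ?_)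
    rw [Set.uIoc_of_le hR] at ht
    exact hA t ht.1
  have hi : IntervalIntegrable (fun θ => Real.log (repNormSq F (circleMap 0 R θ))) volume 0
      (2 * Real.pi) := (hu.continuous.comp (hcm R)).intervalIntegrable _ _
  rw [hB, integral_circle_sub_center hu (fderiv_log_repNormSq hF h0) hβ.continuous,
    intervalIntegral.integral_sub hi intervalIntegrable_const,
    intervalIntegral.integral_const, Real.circleAverage_def]
  have := Real.pi_pos
  simp only [smul_eq_mul, sub_zero]
  field_simp

end Jensen

/-! ### Zero-dimensional sets in the Zariski topology -/

open TopologicalSpace in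
/-- In dimension zero every irreducible component is a point, and a Noetherian space has finitely
many of them. -/
theorem finite_of_topologicalKrullDim_nonpos {X : Type*} [TopologicalSpace X] [NoetherianSpace X]
    [T1Space X] (h : topologicalKrullDim X ≤ 0) : Finite X := by
  have hmax := Order.krullDim_nonpos_iff_forall_isMax.mp h
  have hsing : ∀ x : X, irreducibleComponent x = {x} := by
    intro x
    let A : IrreducibleCloseds X := ⟨{x}, isIrreducible_singleton, isClosed_singleton⟩
    let B : IrreducibleCloseds X :=
      ⟨irreducibleComponent x, isIrreducible_irreducibleComponent, isClosed_irreducibleComponent⟩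
    have hAB : A ≤ B := by
      intro y hy
      have : y = x := hy
      rw [this]
      exact mem_irreducibleComponent
    exact Set.Subset.antisymm (hmax A hAB) hAB
  have hfin := NoetherianSpace.finite_irreducibleComponents (α := X)
  have := hfin.to_subtype
  refine Finite.of_injective (β := irreducibleComponents X)
    (fun x => ⟨irreducibleComponent x, irreducibleComponent_mem_irreducibleComponents x⟩)
    fun x y hxy => ?_
  have h1 : irreducibleComponent x = irreducibleComponent y := congrArg Subtype.val hxy
  rw [hsing, hsing] at h1
  exact Set.singleton_injective h1

/-- The Zariski topology is Noetherian: a closed set is recovered from the ideal of polynomials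
vanishing at the chosen representatives of its points, which need not be a homogeneous ideal. -/
theorem noetherianSpace_zariski : @TopologicalSpace.NoetherianSpace (ProjSpace N) (zariski N) := by
  let _ := zariski N
  refine ((TopologicalSpace.noetherianSpace_TFAE (ProjSpace N)).out 0 1).mpr ?_
  let J : TopologicalSpace.Closeds (ProjSpace N) → Ideal (MvPolynomial (Fin (N + 1)) ℂ) :=
    fun V => ⨅ p ∈ V, RingHom.ker (MvPolynomial.eval p.rep)
  have hJ : ∀ V P, P ∈ J V ↔ ∀ p ∈ V, MvPolynomial.eval p.rep P = 0 := by
    intro V P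
    simp [J, RingHom.mem_ker]
  have hrec : ∀ V W : TopologicalSpace.Closeds (ProjSpace N), J W ≤ J V → V ≤ W := by
    intro V W h p hp
    obtain ⟨S, -, hS⟩ := (isClosed_zariski_iff (W : Set (ProjSpace N))).mp W.isClosed
    change p ∈ (W : Set (ProjSpace N))
    rw [hS]
    refine Set.mem_iInter₂.mpr fun P hP => (hJ V P).mp (h ((hJ W P).mpr fun x hx => ?_)) p hp
    have hx' : x ∈ (W : Set (ProjSpace N)) := hx
    rw [hS] at hx'
    exact Set.mem_iInter₂.mp hx' P hP
  have hanti : StrictAnti J := by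
    intro V W hVW
    refine lt_of_le_not_ge (fun P hP => ?_) fun h => hVW.not_ge (hrec W V h)
    rw [hJ] at hP ⊢
    exact fun p hp => hP p (hVW.le hp)
  exact hanti.wellFoundedLT

theorem t1Space_zariski : @T1Space (ProjSpace N) (zariski N) := by
  let _ := zariski N
  refine ⟨fun p => (isClosed_zariski_iff _).mpr ⟨{P | ∃ i j, P =
    MvPolynomial.C (p.rep j) * MvPolynomial.X i - MvPolynomial.C (p.rep i) * MvPolynomial.X j},
    ?_, ?_⟩⟩
  · rintro P ⟨i, j, rfl⟩
    exact ⟨0 + 1, ((MvPolynomial.isHomogeneous_C _ _).mul (MvPolynomial.isHomogeneous_X _ _)).sub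
      ((MvPolynomial.isHomogeneous_C _ _).mul (MvPolynomial.isHomogeneous_X _ _))⟩
  · ext x
    simp only [Set.mem_singleton_iff, Set.mem_iInter]
    constructor
    · rintro rfl P ⟨i, j, rfl⟩
      simp only [zeroSet, Set.mem_ofPred_eq, map_sub, map_mul, MvPolynomial.eval_C,
        MvPolynomial.eval_X]
      ring
    · intro h
      have hx : ∀ i j, p.rep j * x.rep i = p.rep i * x.rep j := by
        intro i j
        have := h _ ⟨i, j, rfl⟩
        simpa [zeroSet, sub_eq_zero] using this
      obtain ⟨j, hj⟩ := Function.ne_iff.mp p.rep_nonzero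
      rw [← x.mk_rep, ← p.mk_rep, Projectivization.mk_eq_mk_iff']
      refine ⟨x.rep j / p.rep j, funext fun i => ?_⟩
      have hj' : p.rep j ≠ 0 := hj
      rw [Pi.smul_apply, smul_eq_mul, div_mul_eq_mul_div, div_eq_iff hj', mul_comm _ (p.rep j),
        hx i j, mul_comm]

theorem finite_of_algDim_eq_zero {X : Set (ProjSpace N)} (h : algDim X = 0) : X.Finite := by
  let _ := zariski N
  have : TopologicalSpace.NoetherianSpace (ProjSpace N) := noetherianSpace_zariski
  have : T1Space (ProjSpace N) := t1Space_zariski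
  have : Finite X := finite_of_topologicalKrullDim_nonpos (X := X) h.le
  exact X.toFinite

/-- A linear form without zeros on a finite set, found among the forms `∑ t ^ i X_i`. -/
theorem exists_linearForm_ne_zero {X : Set (ProjSpace N)} (hX : X.Finite) :
    ∃ L : MvPolynomial (Fin (N + 1)) ℂ, L.IsHomogeneous 1 ∧ ∀ p ∈ X, p ∉ zeroSet L := by
  let Q : ProjSpace N → Polynomial ℂ := fun p =>
    ∑ i : Fin (N + 1), Polynomial.C (p.rep i) * Polynomial.X ^ (i : ℕ)
  have hQ : ∀ p, Q p ≠ 0 := by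
    intro p h
    apply p.rep_nonzero
    funext i
    have := congrArg (fun R => Polynomial.coeff R (i : ℕ)) h
    simpa [Q, Polynomial.finsetSum_coeff, Polynomial.coeff_C_mul, Polynomial.coeff_X_pow,
      Fin.val_inj] using this
  have hfin : (⋃ p ∈ X, {t | (Q p).IsRoot t}).Finite :=
    hX.biUnion fun p _ => Polynomial.finite_setOfPred_isRoot (hQ p)
  obtain ⟨t, ht⟩ := hfin.exists_notMem
  refine ⟨∑ i : Fin (N + 1), MvPolynomial.C (t ^ (i : ℕ)) * MvPolynomial.X i, ?_, fun p hp h => ?_⟩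
  · refine MvPolynomial.IsHomogeneous.sum _ _ _ fun i _ => ?_
    exact MvPolynomial.isHomogeneous_C_mul_X _ i
  · refine ht (Set.mem_iUnion₂.mpr ⟨p, hp, ?_⟩)
    have h' : MvPolynomial.eval p.rep
      (∑ i : Fin (N + 1), MvPolynomial.C (t ^ (i : ℕ)) * MvPolynomial.X i) = 0 := h
    rw [Set.mem_ofPred_eq, Polynomial.IsRoot, Polynomial.eval_finsetSum, ← h', map_sum]
    refine Finset.sum_congr rfl fun i _ => ?_
    simp only [Polynomial.eval_mul, Polynomial.eval_C, Polynomial.eval_pow, Polynomial.eval_X,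
      map_mul, MvPolynomial.eval_C, MvPolynomial.eval_X]
    exact mul_comm _ _

/-! ### Homogeneous forms along a curve -/

theorem norm_eval_le_of_isHomogeneous {d : ℕ} {P : MvPolynomial (Fin (N + 1)) ℂ}
    (hP : P.IsHomogeneous d) :
    ∃ C, 0 ≤ C ∧ ∀ v : Fin (N + 1) → ℂ, ‖MvPolynomial.eval v P‖ ≤ C * ‖v‖ ^ d := by
  refine ⟨∑ m ∈ P.support, ‖P.coeff m‖, Finset.sum_nonneg fun _ _ => norm_nonneg _, fun v => ?_⟩
  rw [MvPolynomial.eval_eq, Finset.sum_mul]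
  refine (norm_sum_le _ _).trans (Finset.sum_le_sum fun m hm => ?_)
  rw [norm_mul, norm_prod]
  have hdeg : ∑ i ∈ m.support, m i = d := by
    have h := hP (MvPolynomial.mem_support_iff.mp hm)
    rw [Finsupp.weight_apply, Finsupp.sum] at h
    simpa using h
  rw [← hdeg, ← Finset.prod_pow_eq_pow_sum]
  gcongr with i
  rw [norm_pow]
  gcongr
  exact norm_le_pi_norm v i

/-- Compactness of the unit sphere in the cone over `V`. -/
theorem exists_norm_pow_le_sum_norm_eval {V : Set (ProjSpace N)} (hV : IsAlgebraicSet V)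
    {ι : Type*} [Fintype ι] {d : ℕ} {Q : ι → MvPolynomial (Fin (N + 1)) ℂ}
    (hQ : ∀ i, (Q i).IsHomogeneous d) (h0 : ∀ p ∈ V, ∃ i, p ∉ zeroSet (Q i)) :
    ∃ c, 0 < c ∧ ∀ (v : Fin (N + 1) → ℂ) (hv : v ≠ 0), Projectivization.mk ℂ v hv ∈ V →
      c * ‖v‖ ^ d ≤ ∑ i, ‖MvPolynomial.eval v (Q i)‖ := by
  obtain ⟨S, hS, rfl⟩ := hV
  set K : Set (Fin (N + 1) → ℂ) :=
    Metric.sphere 0 1 ∩ ⋂ P ∈ S, {v | MvPolynomial.eval v P = 0} with hK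
  have hKc : IsCompact K := (isCompact_sphere 0 1).inter_right
    (isClosed_biInter fun P _ => isClosed_eq (MvPolynomial.continuous_eval P) continuous_const)
  have hcont : Continuous fun v => ∑ i, ‖MvPolynomial.eval v (Q i)‖ :=
    continuous_finsetSum _ fun i _ => (MvPolynomial.continuous_eval (Q i)).norm
  have hmk : ∀ (v : Fin (N + 1) → ℂ) (hv : v ≠ 0),
      Projectivization.mk ℂ v hv ∈ ⋂ P ∈ S, zeroSet P ↔
        ∀ P ∈ S, MvPolynomial.eval v P = 0 := by
    intro v hv
    rw [Set.mem_iInter₂]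
    refine forall₂_congr fun P hP => ?_
    obtain ⟨e, he⟩ := hS P hP
    exact mk_mem_zeroSet_iff he v hv
  have hpos : ∀ v ∈ K, 0 < ∑ i, ‖MvPolynomial.eval v (Q i)‖ := by
    rintro v ⟨hv1, hv2⟩
    have hv : v ≠ 0 := by
      rintro rfl
      simp at hv1
    obtain ⟨i, hi⟩ := h0 _ ((hmk v hv).mpr fun P hP => Set.mem_iInter₂.mp hv2 P hP)
    rw [mk_mem_zeroSet_iff (hQ i)] at hi
    exact Finset.sum_pos' (fun _ _ => norm_nonneg _)
      ⟨i, Finset.mem_univ i, norm_pos_iff.mpr hi⟩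
  obtain ⟨c, hc, hcK⟩ := hKc.exists_forall_le' hcont.continuousOn hpos
  refine ⟨c, hc, fun v hv hvV => ?_⟩
  have hn : 0 < ‖v‖ := norm_pos_iff.mpr hv
  set u : Fin (N + 1) → ℂ := ((‖v‖⁻¹ : ℝ) : ℂ) • v with hu
  have hvu : v = ((‖v‖ : ℝ) : ℂ) • u := by
    rw [hu, smul_smul, ← Complex.ofReal_mul, mul_inv_cancel₀ hn.ne', Complex.ofReal_one, one_smul]
  have huK : u ∈ K := by
    refine ⟨?_, Set.mem_iInter₂.mpr fun P hP => ?_⟩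
    · rw [mem_sphere_zero_iff_norm, hu, norm_smul, Complex.norm_real,
        Real.norm_of_nonneg (by positivity), inv_mul_cancel₀ hn.ne']
    · obtain ⟨e, he⟩ := hS P hP
      rw [Set.mem_ofPred_eq, hu, eval_smul_of_isHomogeneous he, (hmk v hv).mp hvV P hP, mul_zero]
  have h1 : ∀ i, ‖MvPolynomial.eval v (Q i)‖ = ‖v‖ ^ d * ‖MvPolynomial.eval u (Q i)‖ := by
    intro i
    conv_lhs => rw [hvu]
    rw [eval_smul_of_isHomogeneous (hQ i), norm_mul, norm_pow, Complex.norm_real, norm_norm]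
  simp only [h1, ← Finset.mul_sum]
  rw [mul_comm]
  exact mul_le_mul_of_nonneg_left (hcK u huK) (by positivity)

theorem hasDerivAt_eval {F : Fin (N + 1) → ℂ → ℂ} (hF : ∀ j, Differentiable ℂ (F j))
    (P : MvPolynomial (Fin (N + 1)) ℂ) (z : ℂ) :
    HasDerivAt (fun z => MvPolynomial.eval (fun j => F j z) P)
      (∑ k, MvPolynomial.eval (fun j => F j z) (MvPolynomial.pderiv k P) * deriv (F k) z) z := by
  induction P using MvPolynomial.induction_on with
  | C a => simpa using hasDerivAt_const z a
  | add p q hp hq =>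
    simp only [map_add, add_mul, Finset.sum_add_distrib]
    exact hp.add hq
  | mul_X p i hp =>
    simp only [map_mul, MvPolynomial.eval_X]
    refine (hp.mul (hF i z).hasDerivAt).congr_deriv ?_
    simp only [Derivation.leibniz, smul_eq_mul, map_add, map_mul, MvPolynomial.eval_X, add_mul,
      Finset.sum_add_distrib, MvPolynomial.pderiv_X, Pi.single_apply]
    rw [add_comm]
    congr 1
    · rw [Finset.sum_eq_single i]
      · simp
      · intro k _ hk
        simp [hk.symm]
      · simp
    · rw [Finset.sum_mul]
      exact Finset.sum_congr rfl fun k _ => by ring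

theorem norm_wedge_le {F : Fin (N + 1) → ℂ → ℂ} (h0 : ∀ z, ∃ j, F j z ≠ 0) (z : ℂ)
    (k l : Fin (N + 1)) :
    ‖deriv (F k) z * F l z - F k z * deriv (F l) z‖ ≤ fsDeriv F z * repNormSq F z := by
  have hS := repNormSq_pos h0 z
  have hfs : 0 ≤ fsDeriv F z := fsDeriv_nonneg F z
  rcases eq_or_ne l k with rfl | hkl
  · rw [mul_comm, sub_self, norm_zero]
    positivity
  · refine le_of_sq_le_sq ?_ (by positivity)
    rw [mul_pow, fsDeriv_sq, div_mul_cancel₀ _ (by positivity)]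
    refine le_trans ?_ (Finset.single_le_sum (f := fun i => ∑ j ∈ Finset.univ.erase i,
      ‖deriv (F i) z * F j z - F i z * deriv (F j) z‖ ^ 2)
      (fun i _ => Finset.sum_nonneg fun _ _ => by positivity) (Finset.mem_univ k))
    exact Finset.single_le_sum
      (f := fun j => ‖deriv (F k) z * F j z - F k z * deriv (F j) z‖ ^ 2)
      (fun _ _ => by positivity) (Finset.mem_erase.mpr ⟨hkl, Finset.mem_univ l⟩)

theorem repNormSq_le (F : Fin (N + 1) → ℂ → ℂ) (z : ℂ) :
    repNormSq F z ≤ (N + 1) * ‖fun j => F j z‖ ^ 2 := by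
  have : repNormSq F z ≤ ∑ _j : Fin (N + 1), ‖fun j => F j z‖ ^ 2 :=
    Finset.sum_le_sum fun j _ => by
      have := norm_le_pi_norm (fun j => F j z) j
      gcongr
  simpa using this

/-- The Wronskian of `P(F)` and `Q(F)` in terms of those of the components of `F`, by Euler's
identity. -/
theorem deriv_eval_wedge {F : Fin (N + 1) → ℂ → ℂ} (hF : ∀ j, Differentiable ℂ (F j)) {d : ℕ}
    {P Q : MvPolynomial (Fin (N + 1)) ℂ} (hP : P.IsHomogeneous d) (hQ : Q.IsHomogeneous d)
    (z : ℂ) :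
    (d : ℂ) * (deriv (fun z => MvPolynomial.eval (fun j => F j z) P) z *
        MvPolynomial.eval (fun j => F j z) Q - MvPolynomial.eval (fun j => F j z) P *
        deriv (fun z => MvPolynomial.eval (fun j => F j z) Q) z) =
      ∑ k, ∑ l, MvPolynomial.eval (fun j => F j z) (MvPolynomial.pderiv k P) *
        MvPolynomial.eval (fun j => F j z) (MvPolynomial.pderiv l Q) *
          (deriv (F k) z * F l z - F k z * deriv (F l) z) := by
  have euler : ∀ R : MvPolynomial (Fin (N + 1)) ℂ, R.IsHomogeneous d →
      (d : ℂ) * MvPolynomial.eval (fun j => F j z) R =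
        ∑ l, F l z * MvPolynomial.eval (fun j => F j z) (MvPolynomial.pderiv l R) := by
    intro R hR
    have := congrArg (MvPolynomial.eval fun j => F j z) hR.sum_X_mul_pderiv
    simpa [eq_comm] using this
  rw [(hasDerivAt_eval hF P z).deriv, (hasDerivAt_eval hF Q z).deriv, mul_sub, mul_left_comm,
    euler Q hQ, ← mul_assoc, euler P hP, Finset.sum_mul_sum, Finset.sum_mul_sum,
    ← Finset.sum_sub_distrib]
  refine Finset.sum_congr rfl fun k _ => ?_
  rw [← Finset.sum_sub_distrib]
  exact Finset.sum_congr rfl fun l _ => by ring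

theorem exists_norm_deriv_eval_wedge_le {d : ℕ} (hd : d ≠ 0)
    {P Q : MvPolynomial (Fin (N + 1)) ℂ} (hP : P.IsHomogeneous d) (hQ : Q.IsHomogeneous d) :
    ∃ C, 0 ≤ C ∧ ∀ F : Fin (N + 1) → ℂ → ℂ, (∀ j, Differentiable ℂ (F j)) →
      (∀ z, ∃ j, F j z ≠ 0) → ∀ z,
      ‖deriv (fun z => MvPolynomial.eval (fun j => F j z) P) z *
        MvPolynomial.eval (fun j => F j z) Q - MvPolynomial.eval (fun j => F j z) P *
        deriv (fun z => MvPolynomial.eval (fun j => F j z) Q) z‖ ≤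
      C * (‖fun j => F j z‖ ^ d) ^ 2 * fsDeriv F z := by
  choose A hA0 hA using fun k => norm_eval_le_of_isHomogeneous (hP.pderiv (i := k))
  choose B hB0 hB using fun k => norm_eval_le_of_isHomogeneous (hQ.pderiv (i := k))
  refine ⟨∑ k, ∑ l, A k * B l * (N + 1), Finset.sum_nonneg fun k _ => Finset.sum_nonneg fun l _ =>
    mul_nonneg (mul_nonneg (hA0 k) (hB0 l)) (by positivity), fun F hF h0 z => ?_⟩
  have hd1 : (1 : ℝ) ≤ d := by exact_mod_cast Nat.one_le_iff_ne_zero.mpr hd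
  have hfs : 0 ≤ fsDeriv F z := fsDeriv_nonneg F z
  set W := deriv (fun z => MvPolynomial.eval (fun j => F j z) P) z *
        MvPolynomial.eval (fun j => F j z) Q - MvPolynomial.eval (fun j => F j z) P *
        deriv (fun z => MvPolynomial.eval (fun j => F j z) Q) z with hW
  have h1 : ‖W‖ ≤ ‖(d : ℂ) * W‖ := by
    rw [norm_mul, Complex.norm_natCast]
    exact le_mul_of_one_le_left (norm_nonneg _) hd1
  refine h1.trans ?_
  rw [hW, deriv_eval_wedge hF hP hQ, Finset.sum_mul, Finset.sum_mul]
  refine (norm_sum_le _ _).trans (Finset.sum_le_sum fun k _ => ?_)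
  rw [Finset.sum_mul, Finset.sum_mul]
  refine (norm_sum_le _ _).trans (Finset.sum_le_sum fun l _ => ?_)
  rw [norm_mul, norm_mul]
  set ρ := ‖fun j => F j z‖ with hρ
  have hρ0 : 0 ≤ ρ := norm_nonneg _
  calc _ ≤ (A k * ρ ^ (d - 1)) * (B l * ρ ^ (d - 1)) * (fsDeriv F z * ((N + 1) * ρ ^ 2)) := by
        have := hA k fun j => F j z
        have := hB l fun j => F j z
        have h2 := norm_wedge_le h0 z k l
        have h3 := repNormSq_le F z
        have := hA0 k
        have := hB0 l
        gcongr
        exact h2.trans (by gcongr)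
    _ = A k * B l * (N + 1) * (ρ ^ (d - 1) * ρ) ^ 2 * fsDeriv F z := by ring
    _ = _ := by rw [← pow_succ, Nat.sub_add_cancel (Nat.one_le_iff_ne_zero.mpr hd)]

/-! ### Growth estimates for the characteristic -/

theorem circleAverage_log_norm_of_ne_zero {H : ℂ → ℂ} (hH : Differentiable ℂ H)
    (h0 : ∀ z, H z ≠ 0) (R : ℝ) :
    Real.circleAverage (fun z => Real.log ‖H z‖) 0 R = Real.log ‖H 0‖ := by
  refine InnerProductSpace.HarmonicOnNhd.circleAverage_eq fun z _ => ?_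
  exact (hH.analyticAt z).harmonicAt_log_norm (h0 z)

theorem log_repNormSq_le {F : Fin (N + 1) → ℂ → ℂ} (h0 : ∀ z, ∃ j, F j z ≠ 0) {d : ℕ} (hd : d ≠ 0)
    {c M : ℝ} (hc : 0 < c) {z : ℂ} (h : c * ‖fun j => F j z‖ ^ d ≤ M) :
    Real.log (repNormSq F z) ≤ Real.log (N + 1) + 2 / d * (Real.log M - Real.log c) := by
  have hρ : 0 < ‖fun j => F j z‖ := by
    obtain ⟨j, hj⟩ := h0 z
    exact (norm_pos_iff.mpr hj).trans_le (norm_le_pi_norm (fun j => F j z) j)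
  have hd0 : (0 : ℝ) < d := by exact_mod_cast Nat.pos_of_ne_zero hd
  have h1 := Real.log_le_log (repNormSq_pos h0 z) (repNormSq_le F z)
  have h2 := Real.log_le_log (by positivity) h
  rw [Real.log_mul (by positivity) (by positivity), Real.log_pow] at h1 h2
  have h3 : Real.log ‖fun j => F j z‖ ≤ (Real.log M - Real.log c) / d := by
    rw [le_div_iff₀ hd0]
    linarith
  calc _ ≤ _ := h1
    _ ≤ Real.log (N + 1) + 2 * ((Real.log M - Real.log c) / d) := by
      push_cast
      linarith
    _ = _ := by ring

theorem characteristic_nonneg (F : Fin (N + 1) → ℂ → ℂ) {R : ℝ} (hR : 0 ≤ R) :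
    0 ≤ characteristic F R := by
  refine intervalIntegral.integral_nonneg hR fun t ht => ?_
  have h1 : 0 ≤ ∫ z in Metric.closedBall (0 : ℂ) t, fsDeriv F z ^ 2 :=
    integral_nonneg fun z => sq_nonneg _
  have := ht.1
  have := Real.pi_pos
  positivity

/-- A pointwise upper bound for `log ‖F‖²` modulo the harmonic function `log |H|` bounds the
characteristic. -/
theorem characteristic_le_of_log_le {F : Fin (N + 1) → ℂ → ℂ} (hF : ∀ j, Differentiable ℂ (F j))
    (h0 : ∀ z, ∃ j, F j z ≠ 0) {H : ℂ → ℂ} (hH : Differentiable ℂ H) (hH0 : ∀ z, H z ≠ 0)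
    {A B C σ : ℝ} (hle : ∀ z, Real.log (repNormSq F z) ≤
      A + B * Real.log ‖H z‖ + C * (1 + ‖z‖) ^ (σ + 1)) {R : ℝ} (hR : 0 ≤ R) :
    characteristic F R ≤
      A + B * Real.log ‖H 0‖ + C * (1 + R) ^ (σ + 1) - Real.log (repNormSq F 0) := by
  rw [characteristic_eq_circleAverage hF h0 hR, sub_le_sub_iff_right]
  have hlogH : Continuous fun z => Real.log ‖H z‖ :=
    hH.continuous.norm.log fun z => norm_ne_zero_iff.mpr (hH0 z)
  have hBH : Continuous fun z => B • Real.log ‖H z‖ := hlogH.const_smul B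
  have hlogS : Continuous fun z => Real.log (repNormSq F z) :=
    (continuous_repNormSq hF).log fun z => (repNormSq_pos h0 z).ne'
  have hci : ∀ u : ℂ → ℝ, Continuous u → CircleIntegrable u 0 R := fun u hu =>
    hu.continuousOn.circleIntegrable hR
  calc Real.circleAverage (fun z => Real.log (repNormSq F z)) 0 R
      ≤ Real.circleAverage (fun z => (A + C * (1 + R) ^ (σ + 1)) + B • Real.log ‖H z‖) 0 R := by
        refine Real.circleAverage_mono (hci _ hlogS)
          (hci _ (continuous_const.add hBH)) fun z hz => ?_
        rw [mem_sphere_zero_iff_norm, abs_of_nonneg hR] at hz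
        have := hle z
        rw [hz] at this
        rw [smul_eq_mul]
        linarith
    _ = _ := by
        rw [Real.circleAverage_fun_add (hci _ continuous_const)
          (hci _ hBH), Real.circleAverage_const,
          Real.circleAverage_fun_smul, circleAverage_log_norm_of_ne_zero hH hH0, smul_eq_mul]
        ring

theorem isBigO_rpow_of_le {T : ℝ → ℝ} {A C s : ℝ} (hs : 0 ≤ s) (hC : 0 ≤ C)
    (hT0 : ∀ r, 0 ≤ r → 0 ≤ T r) (hT : ∀ r, 0 ≤ r → T r ≤ A + C * (1 + r) ^ s) :
    T =O[atTop] fun r => r ^ s := by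
  refine IsBigO.of_bound (|A| + C * 2 ^ s) ?_
  filter_upwards [eventually_ge_atTop (1 : ℝ)] with r hr
  have hr0 : 0 ≤ r := by linarith
  rw [Real.norm_of_nonneg (hT0 r hr0), Real.norm_of_nonneg (by positivity)]
  have h1 : (1 + r) ^ s ≤ 2 ^ s * r ^ s := by
    rw [← Real.mul_rpow (by norm_num) hr0]
    gcongr
    linarith
  have h2 : (1 : ℝ) ≤ r ^ s := Real.one_le_rpow hr hs
  calc T r ≤ A + C * (1 + r) ^ s := hT r hr0
    _ ≤ |A| * r ^ s + C * (2 ^ s * r ^ s) := by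
      refine add_le_add ((le_abs_self A).trans (le_mul_of_one_le_right (abs_nonneg A) h2)) ?_
      gcongr
    _ = _ := by ring

/-- A bound on the Wronskian of `g₁` and `g₂` bounds the difference of their logarithmic derivatives at
a point where both have the same modulus `m`. -/
theorem norm_logDeriv_sub_le_of_tie {g₁ g₂ : ℂ → ℂ} {z : ℂ} {m a K s : ℝ} (hm : 0 < m)
    (h1 : ‖g₁ z‖ = m) (h2 : ‖g₂ z‖ = m) (ha : 0 ≤ a) (ham : a ≤ K * m) {C : ℝ} (hC : 0 ≤ C)
    (hs : 0 ≤ s)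
    (hW : ‖deriv g₁ z * g₂ z - g₁ z * deriv g₂ z‖ ≤ C * a ^ 2 * s) :
    ‖logDeriv g₁ z - logDeriv g₂ z‖ ≤ C * K ^ 2 * s := by
  have hg1 : g₁ z ≠ 0 := norm_pos_iff.mp (h1 ▸ hm)
  have hg2 : g₂ z ≠ 0 := norm_pos_iff.mp (h2 ▸ hm)
  rw [logDeriv_apply, logDeriv_apply, div_sub_div _ _ hg1 hg2, norm_div, norm_mul, h1, h2,
    div_le_iff₀ (by positivity)]
  calc _ ≤ _ := hW
    _ ≤ C * (K * m) ^ 2 * s := by gcongr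
    _ = _ := by ring

/-- Forms of equal degree without common zero on `V`, all but one of which vanish at most on the given
hypersurfaces. -/
theorem exists_forms {V : Set (ProjSpace N)} {q : ℕ} (D : Fin q → Hypersurface N)
    (hfin : ((⋂ i, (D i).supp) ∩ V).Finite) :
    ∃ d : ℕ, d ≠ 0 ∧ ∃ Q : Option (Fin q) → MvPolynomial (Fin (N + 1)) ℂ,
      (∀ i, (Q i).IsHomogeneous d) ∧ (∀ i, zeroSet (Q (some i)) ⊆ (D i).supp) ∧
        ∀ p ∈ V, ∃ i, p ∉ zeroSet (Q i) := by
  have hpow : ∀ (P : MvPolynomial (Fin (N + 1)) ℂ) (n : ℕ), zeroSet (P ^ n) ⊆ zeroSet P := by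
    intro P n p hp
    have : MvPolynomial.eval p.rep (P ^ n) = 0 := hp
    rw [map_pow] at this
    exact eq_zero_of_pow_eq_zero this
  obtain ⟨L, hL, hLX⟩ := exists_linearForm_ne_zero hfin
  set d := ∏ i, (D i).degree with hd
  refine ⟨d, Finset.prod_ne_zero_iff.mpr fun i _ => (D i).degree_pos.ne', fun o => o.elim (L ^ d)
    fun i => (D i).poly ^ ∏ j ∈ Finset.univ.erase i, (D j).degree, ?_, fun i => hpow _ _, ?_⟩
  · rintro (_ | i)
    · simpa using hL.pow d
    · have := (D i).isHomogeneous.pow (∏ j ∈ Finset.univ.erase i, (D j).degree)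
      rwa [Finset.mul_prod_erase _ (fun j => (D j).degree) (Finset.mem_univ i)] at this
  · intro p hp
    by_cases h : ∀ i, p ∈ (D i).supp
    · exact ⟨none, fun h' => hLX p ⟨Set.mem_iInter.mpr h, hp⟩ (hpow _ _ h')⟩
    · push Not at h
      obtain ⟨i, hi⟩ := h
      exact ⟨some i, fun h' => hi (hpow _ _ h')⟩

end HolCurves

end

theorem theorem1p1 (N : ℕ) (V : Set (HolCurves.ProjSpace N)) (hV : HolCurves.IsAlgebraicSet V)
    (q : ℕ) (D : Fin q → HolCurves.Hypersurface N)
    (hdim : HolCurves.algDim ((⋂ i, (D i).supp) ∩ V) = 0)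
    (f : ℂ → HolCurves.ProjSpace N) (F : Fin (N + 1) → ℂ → ℂ)
    (hF : HolCurves.IsHomogeneousRep F f) (hfV : ∀ z, f z ∈ V)
    (σ : ℝ) (hσ : -1 < σ)
    (hder : (fun z : ℂ => HolCurves.fsDeriv F z) =O[cocompact ℂ] fun z : ℂ => ‖z‖ ^ σ)
    (hdisj : (⋃ i, (D i).supp) ∩ Set.range f = ∅) :
    (fun r : ℝ => HolCurves.characteristic F r) =O[atTop] fun r : ℝ => r ^ (σ + 1) := by
  obtain ⟨hFd, hFf⟩ := hF
  choose hv hfv using hFf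
  have h0 : ∀ z, ∃ j, F j z ≠ 0 := fun z => Function.ne_iff.mp (hv z)
  have hvV : ∀ z, Projectivization.mk ℂ (fun j => F j z) (hv z) ∈ V := fun z => hfv z ▸ hfV z
  obtain ⟨d, hd, Q, hQ, hQD, hQV⟩ :=
    HolCurves.exists_forms D (HolCurves.finite_of_algDim_eq_zero hdim)
  obtain ⟨c, hc, hcQ⟩ := HolCurves.exists_norm_pow_le_sum_norm_eval hV hQ hQV
  choose B hB0 hB using fun i j => HolCurves.exists_norm_deriv_eval_wedge_le hd (hQ i) (hQ j)
  set G : Option (Fin q) → ℂ → ℂ := fun i z => MvPolynomial.eval (fun j => F j z) (Q i) with hG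
  have hGd : ∀ i, Differentiable ℂ (G i) := fun i z =>
    (HolCurves.hasDerivAt_eval hFd (Q i) z).differentiableAt
  have hG0 : ∀ i z, G (some i) z ≠ 0 := by
    intro i z h
    have h1 : f z ∈ HolCurves.zeroSet (Q (some i)) := by
      rw [hfv z, HolCurves.mk_mem_zeroSet_iff (hQ _)]
      exact h
    exact hdisj.le ⟨Set.mem_iUnion.mpr ⟨i, hQD i h1⟩, z, rfl⟩
  have hρ : ∀ z, 0 < ‖fun j => F j z‖ := fun z => norm_pos_iff.mpr (hv z)
  set n : ℝ := ((Fintype.card (Option (Fin q)) : ℕ) : ℝ) with hn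
  have hsum : ∀ z M, (∀ i, ‖G i z‖ ≤ M) → c * ‖fun j => F j z‖ ^ d ≤ n * M := by
    intro z M hM
    refine (hcQ _ (hv z) (hvV z)).trans ((Finset.sum_le_sum fun i _ => hM i).trans_eq ?_)
    rw [Finset.sum_const, nsmul_eq_mul, Finset.card_univ]
  -- `none` is the index of the power of the linear form, the only member that may have zeros.
  have hmem : ∀ i, i ∈ (Finset.univ.map Function.Embedding.some).cons (none : Option (Fin q))
      (by simp) := by
    rintro (_ | i) <;> simp
  obtain ⟨C, hC, k, -, hk0, hk⟩ := HolCurves.exists_dominating_of_isBigO (G := G) (a := none)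
    (S := Finset.univ.map Function.Embedding.some)
    (h := fun z => (∑ i, ∑ j, B i j) * (n / c) ^ 2 * HolCurves.fsDeriv F z)
    (continuous_const.mul (HolCurves.continuous_fsDeriv hFd h0)) hσ (hder.const_mul_left _)
    (hGd none) (fun i _ => hGd i) (by simpa using hG0) (by simp)
    (fun z => by
      by_contra! hcon
      have := hsum z 0 fun i => (norm_eq_zero.mpr (hcon i (hmem i))).le
      rw [mul_zero] at this
      have := hρ z
      exact absurd ‹c * _ ≤ 0› (not_le.mpr (by positivity)))
    (fun z i _ j _ hi hj => by
      have hij : ‖G i z‖ = ‖G j z‖ := le_antisymm (hj i (hmem i)) (hi j (hmem j))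
      have hle := hsum z _ fun l => hi l (hmem l)
      have hpos : 0 < c * ‖fun j => F j z‖ ^ d := mul_pos hc (pow_pos (hρ z) d)
      have hm : 0 < ‖G i z‖ := by
        by_contra! hcon
        rw [le_antisymm hcon (norm_nonneg _), mul_zero] at hle
        exact absurd hle (not_le.mpr hpos)
      refine (HolCurves.norm_logDeriv_sub_le_of_tie hm rfl hij.symm (pow_nonneg (hρ z).le d)
        (K := n / c) ?_ (hB0 i j)
        (HolCurves.fsDeriv_nonneg F z) (hB i j F hFd h0 z)).trans ?_
      · rw [div_mul_eq_mul_div, le_div_iff₀ hc, mul_comm]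
        exact hle
      · have h1 : B i j ≤ ∑ i, ∑ j, B i j :=
          (Finset.single_le_sum (fun j _ => hB0 i j) (Finset.mem_univ j)).trans
            (Finset.single_le_sum (f := fun i => ∑ j, B i j)
              (fun i _ => Finset.sum_nonneg fun j _ => hB0 i j) (Finset.mem_univ i))
        exact mul_le_mul_of_nonneg_right (mul_le_mul_of_nonneg_right h1 (sq_nonneg _))
          (HolCurves.fsDeriv_nonneg F z))
  have hn0 : 0 < n := by
    rw [hn]
    exact_mod_cast Fintype.card_pos
  have hlog : ∀ z, Real.log (HolCurves.repNormSq F z) ≤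
      (Real.log (N + 1) + 2 / d * (Real.log n - Real.log c)) + 2 / d * Real.log ‖G k z‖ +
        2 / d * C * (1 + ‖z‖) ^ (σ + 1) := by
    intro z
    refine (HolCurves.log_repNormSq_le h0 hd hc (hsum z _ fun i => hk z i (hmem i))).trans_eq ?_
    rw [Real.log_mul hn0.ne' (mul_ne_zero (norm_ne_zero_iff.mpr (hk0 z)) (Real.exp_ne_zero _)),
      Real.log_mul (norm_ne_zero_iff.mpr (hk0 z)) (Real.exp_ne_zero _), Real.log_exp]
    ring
  refine HolCurves.isBigO_rpow_of_le (C := 2 / d * C)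
    (A := (Real.log (N + 1) + 2 / d * (Real.log n - Real.log c)) + 2 / d * Real.log ‖G k 0‖ -
      Real.log (HolCurves.repNormSq F 0)) (by linarith) (by positivity)
    (fun r hr => HolCurves.characteristic_nonneg F hr) fun r hr => ?_
  refine (HolCurves.characteristic_le_of_log_le hFd h0 (hGd k) hk0 hlog hr).trans_eq ?_
  ring
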